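/- **Model.** An $m\times n$ *board* is a partition of $\{1,\dots,m\}\times\{1,\dots,n\}$ into open and blocked locations. Fix a finite alphabet $\Sigma$ of labels and an affinity function $G:\Sigma\times\Sigma\to\{0,1\}$; labels $a,b$ *stick* if $G(a,b)=G(b,a)=1$. A *configuration* is a board with at most one labeled unit tile on each open location (and none elsewhere). Two tiles at unit distance are bonded if their labels stick; the *polyominoes* of the configuration are the connected components of its tiles under bonding. A *step* in a direction $d\in\{N,E,S,W\}$ translates by one unit in direction $d$ every polyomino that is not stuck, where a polyomino is stuck if its translate would overlap a blocked location or a stuck polyomino; a polyomino whose translate is not contained in the $m\times n$ rectangle is removed from the configuration. Newly bonded polyominoes merge. A *tilt* in direction $d$ repeats steps in direction $d$ until the configuration no longer changes. $C\to_* C'$ means that $C'$ results from $C$ by a nonempty finite sequence of tilts. The *size* of a configuration is the number $mn$ of locations of its board. **Patterned shapes.** For positive integers $h,w,k$ let $U_{h,w,k}$ be the set of all nonempty subsets $u\subseteq\{1,\dots,h\}\times\{1,\dots,w\}$ that are connected in the square lattice, together with a label $x\in\{0,1,\dots,k\}$ for each point of $u$. Fix an injection $\varphi:\{0,\dots,k\}\to\Sigma$.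 A configuration *weakly represents* $u$ (with respect to $\varphi$) if one of its polyominoes is a translate of $u$ in which every tile carries the image under $\varphi$ of the label of the corresponding point, and each other polyomino is a helper, that is, a single tile whose label sticks to no label in $\Sigma$. A configuration $C$ is *weakly universal* for $U_{h,w,k}$ if there is a set $\mathcal C$ of configurations such that every $u\in U_{h,w,k}$ is weakly represented by some element of $\mathcal C$ and $C\to_* C'$ for all $C'\in\mathcal C$. **Theorem.** There is an absolute constant $K$ such that for all positive integers $h,w,k$ there exist a finite alphabet $\Sigma$, an affinity function $G$, an injection $\varphi:\{0,\dots,k\}\to\Sigma$ and a configuration $C$ such that $C$ is weakly universal for $U_{h,w,k}$, the size of $C$ is at most $K\,hwk$, and for every $u\in U_{h,w,k}$ some nonempty sequence of at most $K\,hwk$ tilts reconfigures $C$ into a configuration that weakly represents $u$. -/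

import Mathlib

namespace TiltAssembly

/-- Locations of the two-dimensional square lattice. -/
abbrev Cell : Type := ℤ × ℤ

/-- Two locations are adjacent if they differ by one unit in exactly one coordinate. -/
def Adjacent (p q : Cell) : Prop := |p.1 - q.1| + |p.2 - q.2| = 1

lemma Adjacent.symm {p q : Cell} (h : Adjacent p q) : Adjacent q p := by
  unfold Adjacent at *
  rw [abs_sub_comm q.1, abs_sub_comm q.2]
  exact h

/-- The square lattice as a graph. -/
def gridGraph : SimpleGraph Cell where
  Adj := Adjacent
  symm := ⟨fun _ _ h => h.symm⟩
  loopless := ⟨fun p h => by simp [Adjacent] at h⟩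

/-- The four cardinal directions. -/
inductive Dir where
  | N | E | S | W

/-- The unit translation in a given direction. -/
def Dir.vec : Dir → Cell
  | .N => (0, 1)
  | .E => (1, 0)
  | .S => (0, -1)
  | .W => (-1, 0)

/-- The locations `{1, …, m} × {1, …, n}`. -/
def box (m n : ℕ) : Set Cell :=
  {p | 1 ≤ p.1 ∧ p.1 ≤ m ∧ 1 ≤ p.2 ∧ p.2 ≤ n}

/-- An `m × n` board: a partition of `box m n` into open and blocked locations. -/
structure Board where
  m : ℕ
  n : ℕ
  opn : Set Cell
  opn_subset : opn ⊆ box m n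

/-- All locations of the board. -/
def Board.region (B : Board) : Set Cell := box B.m B.n

/-- The blocked locations of the board. -/
def Board.blocked (B : Board) : Set Cell := B.region \ B.opn

/-- A tile: a coordinate together with an attachment label. -/
abbrev Tile (Λ : Type) : Type := Cell × Λ

/-- A configuration over the label alphabet `Λ`: a board, with at most one tile on each open
location and no tile elsewhere; `label c = some a` says that `(c, a)` is a tile.
Adjacent tiles that attract each other belong to the same polyomino, so that the polyominoes of
the configuration are the connected components of the bonding graph of its tiles
(see `Config.polyominoes`). -/
@[ext] structure Config (Λ : Type) where
  board : Board
  label : Cell → Option Λ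
  label_open : ∀ c a, label c = some a → c ∈ board.opn

/-- Labels `a`, `b` stick together for the affinity function `G` (`true` is 1, `false` is 0). -/
def Sticks {Λ : Type} (G : Λ → Λ → Bool) (a b : Λ) : Prop := G a b = true ∧ G b a = true

namespace Config

variable {Λ : Type}

/-- The size of a configuration: the number of locations of its board. -/
def size (C : Config Λ) : ℕ := C.board.m * C.board.n

/-- The location `c` carries a tile. -/
def Occupied (C : Config Λ) (c : Cell) : Prop := ∃ a, C.label c = some a

/-- The bonding graph: locations of adjacent tiles whose labels stick together are joined. -/
def bondGraph (G : Λ → Λ → Bool) (C : Config Λ) : SimpleGraph Cell where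
  Adj p q := Adjacent p q ∧ ∃ a b, C.label p = some a ∧ C.label q = some b ∧ Sticks G a b
  symm := ⟨fun _ _ ⟨h, a, b, ha, hb, h1, h2⟩ => ⟨h.symm, b, a, hb, ha, h2, h1⟩⟩
  loopless := ⟨fun p h => gridGraph.loopless.irrefl p h.1⟩

/-- The polyomino that contains the tile at `p` (for an occupied location `p`). -/
def polyominoAt (G : Λ → Λ → Bool) (C : Config Λ) (p : Cell) : Set (Tile Λ) :=
  {t | (C.bondGraph G).Reachable p t.1 ∧ C.label t.1 = some t.2}

/-- The set of polyominoes of a configuration. -/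
def polyominoes (G : Λ → Λ → Bool) (C : Config Λ) : Set (Set (Tile Λ)) :=
  {P | ∃ p, C.Occupied p ∧ P = C.polyominoAt G p}

/-- The tile at `p` belongs to a polyomino that cannot move one unit in direction `d`: the
translated polyomino would overlap a blocked location, or a polyomino that itself cannot move. -/
inductive Stuck (G : Λ → Λ → Bool) (C : Config Λ) (d : Dir) : Cell → Prop
  | wall (p : Cell) : C.Occupied p → p + d.vec ∈ C.board.blocked → Stuck G C d p
  | push (p : Cell) : C.Occupied p → Stuck G C d (p + d.vec) → Stuck G C d p
  | rigid (p q : Cell) : (C.bondGraph G).Reachable p q → Stuck G C d q → Stuck G C d p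

/-- Translating the polyomino of the tile at `p` by one unit in direction `d` puts one of its
tiles outside the board. -/
def Exits (G : Λ → Λ → Bool) (C : Config Λ) (d : Dir) (p : Cell) : Prop :=
  ∃ q, (C.bondGraph G).Reachable p q ∧ q + d.vec ∉ C.board.region

open Classical in
/-- The labelling of the locations after one step: stuck polyominoes stay, polyominoes that leave
the board are removed, all others move by one unit. -/
noncomputable def stepLabel (G : Λ → Λ → Bool) (d : Dir) (C : Config Λ) (c : Cell) : Option Λ :=
  if Stuck G C d c then C.label c
  else if C.Occupied (c - d.vec) ∧ ¬ Stuck G C d (c - d.vec) ∧ ¬ Exits G C d (c - d.vec) then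
    C.label (c - d.vec)
  else none

/-- One step in direction `d`. Polyominoes that have become bonded are merged, because
polyominoes are the components of the bonding graph. -/
noncomputable def step (G : Λ → Λ → Bool) (d : Dir) (C : Config Λ) : Config Λ where
  board := C.board
  label := C.stepLabel G d
  label_open := by
    intro c a h
    unfold stepLabel at h
    split_ifs at h with h1 h2
    · exact C.label_open c a h
    · obtain ⟨h3, h4, h5⟩ := h2
      by_contra hc
      have hcc : c - d.vec + d.vec = c := sub_add_cancel _ _
      have hreg : c ∈ C.board.region := by
        by_contra hr
        exact h5 ⟨c - d.vec, SimpleGraph.Reachable.refl _, by rwa [hcc]⟩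
      exact h4 (Stuck.wall _ h3 (by rw [hcc]; exact ⟨hreg, hc⟩))

/-- `C` is `d`-terminal: a step in direction `d` does not change it. -/
def Terminal (G : Λ → Λ → Bool) (d : Dir) (C : Config Λ) : Prop := C.step G d = C

/-- The tilt of `C` in direction `d` results in `C'`: steps in direction `d` are applied until a
`d`-terminal configuration is reached. -/
def Tilt (G : Λ → Λ → Bool) (d : Dir) (C C' : Config Λ) : Prop :=
  ∃ j : ℕ, (step G d)^[j] C = C' ∧ C'.Terminal G d

/-- Tilting successively in the directions of the list leads from the first configuration to the
second one. -/
def TiltSequence (G : Λ → Λ → Bool) : List Dir → Config Λ → Config Λ → Prop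
  | [], C, C' => C = C'
  | d :: D, C, C' => ∃ C₁, Tilt G d C C₁ ∧ TiltSequence G D C₁ C'

/-- `C` can be reconfigured into `C'` in one move. -/
def ReconfiguresOne (G : Λ → Λ → Bool) (C C' : Config Λ) : Prop := ∃ d, Tilt G d C C'

/-- `C` can be reconfigured into `C'` through a sequence of tilts. -/
def Reconfigures (G : Λ → Λ → Bool) : Config Λ → Config Λ → Prop :=
  Relation.TransGen (ReconfiguresOne G)

/-- `C` is universal for a set of configurations. -/
def UniversalFor (G : Λ → Λ → Bool) (C : Config Λ) (𝒞 : Set (Config Λ)) : Prop :=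
  ∀ C' ∈ 𝒞, Reconfigures G C C'

end Config

/-- A patterned shape: a finite, nonempty connected set of lattice points, each of which carries
one of the symbols in `α`. (`SimpleGraph.Connected` includes that the set is not empty.) -/
structure PatternedShape (α : Type) where
  cells : Finset Cell
  connected : (gridGraph.induce (cells : Set Cell)).Connected
  symbol : cells → α

/-- All patterned shapes inside `{1, …, h} × {1, …, w}`, with symbols in `α`. -/
def patternedShapesIn (α : Type) (h w : ℕ) : Set (PatternedShape α) :=
  {u | (u.cells : Set Cell) ⊆ box h w}

/-- The tiles of the translate of `u` by `v`, when the symbol `s` is written as the attachment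
label `enc s`. -/
def PatternedShape.tiles {α Λ : Type} (u : PatternedShape α) (enc : α ↪ Λ) (v : Cell) :
    Set (Tile Λ) :=
  {t | ∃ p : u.cells, t = (p.1 + v, enc (u.symbol p))}

/-- A helper polyomino: a single tile whose label does not stick to any label. -/
def IsHelper {Λ : Type} (G : Λ → Λ → Bool) (Q : Set (Tile Λ)) : Prop :=
  ∃ c a, Q = {(c, a)} ∧ ∀ b, ¬ Sticks G a b

namespace Config

variable {α Λ : Type}

/-- `C` weakly represents the patterned shape `u`: one polyomino of `C` is a translate of `u` with
the labels that correspond to the symbols of `u`, and all other polyominoes are helpers. -/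
def WeaklyRepresents (G : Λ → Λ → Bool) (enc : α ↪ Λ) (C : Config Λ) (u : PatternedShape α) :
    Prop :=
  ∃ v : Cell, u.tiles enc v ∈ C.polyominoes G ∧
    ∀ Q ∈ C.polyominoes G, Q ≠ u.tiles enc v → IsHelper G Q

/-- `C` is weakly universal for a set of patterned shapes. -/
def WeaklyUniversal (G : Λ → Λ → Bool) (enc : α ↪ Λ) (C : Config Λ)
    (U : Set (PatternedShape α)) : Prop :=
  ∃ 𝒞 : Set (Config Λ), (∀ u ∈ U, ∃ C' ∈ 𝒞, C'.WeaklyRepresents G enc u) ∧ C.UniversalFor G 𝒞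

end Config

end TiltAssembly

namespace TiltAssembly

/-! The board is a machine that builds the shape row by row. It holds `b = w` layers of `L =
2(k+1)h` tiles each, and every layer contains every word of length `a = h` over symbols and helpers
as a subsequence (`sublist_supply`). Building a row means running through one layer and keeping or
discarding each tile. This takes O(L) tilts per layer on a board of size O(Lw), so both bounds are
O(hwk).

The tiles of a layer queue in a corridor whose east end lies over a shaft. A tilt south lets the
head of the queue fall into the middle corridor. A tilt east then keeps that tile: it rests over the
entrance of the tube, and the next tilt south drops it in. A tilt west discards it through the exit,
and a tilt east restores the rest. So S, E keeps the head and S, W, E discards it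
(`exists_collect`). When `a` tiles are collected, W, S slides the row over the pit and drops it
(`exists_finish`). The columns of pockets form an escapement: a tilt south after a tilt east holds
the layers in place, a tilt south after a tilt west advances them by exactly one layer.

All symbols stick to each other and helpers to nothing, so a shape padded with helpers assembles
itself in the pit. Symbols and helpers alternate in the supply, so the head of the queue never bonds
with its successor and can fall alone. The padding makes every pit row fill the whole width, so
finished rows never slide.

Each tilt is verified by a certificate `Motion`, which prescribes the number of steps of every tile;
`Motion.tilt` shows that such a certificate determines the tilt, so that for each kind of tilt only
linear arithmetic on the board remains. -/

lemma Sticks.symm {Λ : Type} {G : Λ → Λ → Bool} {a b : Λ} (h : Sticks G a b) : Sticks G b a :=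
  ⟨h.2, h.1⟩

/-- Adjacent locations differ by the unit vector of `d` or by the perpendicular one. -/
lemma Adjacent.cases (d : Dir) {p q : Cell} (h : Adjacent p q) :
    q = p + d.vec ∨ p = q + d.vec ∨
      (q.1 = p.1 + d.vec.2 ∧ q.2 = p.2 + d.vec.1) ∨
      (p.1 = q.1 + d.vec.2 ∧ p.2 = q.2 + d.vec.1) := by
  obtain ⟨p1, p2⟩ := p
  obtain ⟨q1, q2⟩ := q
  simp only [Adjacent] at h
  rcases abs_cases (p1 - q1) with h1 | h1 <;> rcases abs_cases (p2 - q2) with h2 | h2 <;>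
    cases d <;> simp only [Dir.vec, Prod.mk_add_mk, Prod.mk.injEq] <;> omega

/-! ### Families of tiles and certificates for tilts -/

namespace Config

variable {Λ ι : Type}

open Classical in
/-- The configuration whose tiles are the tiles on open locations that a relation prescribes. -/
noncomputable def ofRel (B : Board) (T : Cell → Λ → Prop) : Config Λ where
  board := B
  label c := if h : c ∈ B.opn ∧ ∃ a, T c a then some h.2.choose else none
  label_open := by
    intro c a h
    split_ifs at h with h1
    exact h1.1

lemma ofRel_congr {B : Board} {T T' : Cell → Λ → Prop}
    (h : ∀ c ∈ B.opn, ∀ a, T c a ↔ T' c a) : ofRel B T = ofRel B T' := by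
  ext1
  · rfl
  · funext c
    by_cases hc : c ∈ B.opn
    · have : T c = T' c := funext fun a => propext (h c hc a)
      -- The label is chosen from the predicate `T c`; generalizing that predicate lets the choices
      -- be identified.
      have aux : ∀ g : Λ → Prop, T c = g →
          (ofRel B T).label c = (ofRel B fun _ => g).label c := by
        rintro _ rfl
        rfl
      exact aux _ this
    · simp [ofRel, hc]

/-- The configuration of a family of tiles: the tile `i` has the label `lab i` (it is absent if
`lab i = none`) and is at `(x i, y i)` (it is absent if this is not an open location). -/
noncomputable def ofFamily (B : Board) (lab : ι → Option Λ) (x y : ι → ℤ) : Config Λ :=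
  ofRel B fun c a => ∃ i, lab i = some a ∧ (x i, y i) = c

/-- The asymmetry is deliberate: tiles of the first family that have left the open locations, such
as discarded ones, need no counterpart. -/
lemma ofFamily_congr {ι' : Type} {B : Board} {lab : ι → Option Λ} {x y : ι → ℤ}
    {lab' : ι' → Option Λ} {x' y' : ι' → ℤ}
    (h : ∀ i a, lab i = some a → (x i, y i) ∈ B.opn →
      ∃ j, lab' j = some a ∧ x' j = x i ∧ y' j = y i)
    (h' : ∀ j a, lab' j = some a → ∃ i, lab i = some a ∧ x i = x' j ∧ y i = y' j) :
    ofFamily B lab x y = ofFamily B lab' x' y' := by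
  refine ofRel_congr fun c hc a => ⟨?_, ?_⟩
  · rintro ⟨i, hi, rfl⟩
    obtain ⟨j, hj, h1, h2⟩ := h i a hi hc
    exact ⟨j, hj, by rw [h1, h2]⟩
  · rintro ⟨j, hj, rfl⟩
    obtain ⟨i, hi, h1, h2⟩ := h' j a hj
    exact ⟨i, hi, by rw [h1, h2]⟩

lemma ofFamily_label {B : Board} {lab : ι → Option Λ} {x y : ι → ℤ}
    (inj : ∀ i j, (lab i).isSome → (lab j).isSome → (x i, y i) ∈ B.opn →
      x i = x j → y i = y j → i = j) (c : Cell) (a : Λ) :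
    (ofFamily B lab x y).label c = some a ↔ c ∈ B.opn ∧ ∃ i, lab i = some a ∧ (x i, y i) = c := by
  simp only [ofFamily, ofRel]
  split_ifs with h
  · obtain ⟨hc, hex⟩ := h
    obtain ⟨i, hi, hic⟩ := hex.choose_spec
    constructor
    · intro h'
      rw [Option.some.injEq] at h'
      exact ⟨hc, i, by rw [hi, h'], hic⟩
    · rintro ⟨-, j, hj, hjc⟩
      have hij : i = j := by
        have e := hic.trans hjc.symm
        rw [Prod.mk.injEq] at e
        exact inj i j (by simp [hi]) (by simp [hj]) (by rwa [hic]) e.1 e.2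
      subst hij
      exact hi.symm.trans hj
  · constructor
    · intro h'; simp at h'
    · rintro ⟨hc, i, hi⟩
      exact absurd ⟨hc, a, i, hi⟩ h

/-- A certificate for a tilt in direction `d`: the tile `i` of the family moves `δ i` steps, and
then it is stopped by a wall or by a stopped tile, or it has left the board. -/
structure Motion (B : Board) (G : Λ → Λ → Bool) (d : Dir) (lab : ι → Option Λ) (x y : ι → ℤ)
    (δ : ι → ℕ) : Prop where
  inj : ∀ i j, (lab i).isSome → (lab j).isSome → x i = x j → y i = y j → i = j
  opn : ∀ i, (lab i).isSome → ∀ t : ℕ, t < δ i → (x i + t * d.vec.1, y i + t * d.vec.2) ∈ B.opn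
  last : ∀ i, (lab i).isSome → (x i + δ i * d.vec.1, y i + δ i * d.vec.2) ∈ B.region →
    (x i + δ i * d.vec.1, y i + δ i * d.vec.2) ∈ B.opn
  line : ∀ i j, (lab i).isSome → (lab j).isSome → ∀ s : ℕ, 0 < s →
    x j = x i + s * d.vec.1 → y j = y i + s * d.vec.2 → δ i < s + δ j
  side : ∀ i j a b, lab i = some a → lab j = some b → Sticks G a b → ∀ t : ℕ,
    x j + (min t (δ j) : ℕ) * d.vec.1 = x i + (min t (δ i) : ℕ) * d.vec.1 + d.vec.2 →
    y j + (min t (δ j) : ℕ) * d.vec.2 = y i + (min t (δ i) : ℕ) * d.vec.2 + d.vec.1 →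
    (t < δ i ↔ t < δ j)
  rest : ∀ i, (lab i).isSome → (x i + δ i * d.vec.1, y i + δ i * d.vec.2) ∈ B.region →
    (x i + (δ i + 1) * d.vec.1, y i + (δ i + 1) * d.vec.2) ∈ B.blocked ∨
    (x i + (δ i + 1) * d.vec.1, y i + (δ i + 1) * d.vec.2) ∈ B.opn ∧
      ∃ j, (lab j).isSome ∧ x j + δ j * d.vec.1 = x i + (δ i + 1) * d.vec.1 ∧
        y j + δ j * d.vec.2 = y i + (δ i + 1) * d.vec.2 ∧ δ j ≤ δ i
  exit : ∀ i a, lab i = some a → (x i + δ i * d.vec.1, y i + δ i * d.vec.2) ∉ B.region →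
    ∀ j b, lab j = some b → Sticks G a b → ∀ t : ℕ, t < δ i →
    ¬ Adjacent (x i + t * d.vec.1, y i + t * d.vec.2)
      (x j + (min t (δ j) : ℕ) * d.vec.1, y j + (min t (δ j) : ℕ) * d.vec.2)

lemma Stuck.occupied {G : Λ → Λ → Bool} {C : Config Λ} {d : Dir} {p : Cell}
    (h : Stuck G C d p) : C.Occupied p := by
  induction h with
  | wall p h _ => exact h
  | push p h _ _ => exact h
  | rigid p q hr _ ih =>
    obtain ⟨w⟩ := hr
    cases w with
    | nil => exact ih
    | cons h _ => obtain ⟨-, a, b, ha, -, -⟩ := h; exact ⟨a, ha⟩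

namespace Motion

variable {B : Board} {G : Λ → Λ → Bool} {d : Dir} {lab : ι → Option Λ} {x y : ι → ℤ} {δ : ι → ℕ}

/-- The abscissa of a tile after `t` steps. -/
def px (d : Dir) (x : ι → ℤ) (δ : ι → ℕ) (t : ℕ) (i : ι) : ℤ := x i + (min t (δ i) : ℕ) * d.vec.1

/-- The ordinate of a tile after `t` steps. -/
def py (d : Dir) (y : ι → ℤ) (δ : ι → ℕ) (t : ℕ) (i : ι) : ℤ := y i + (min t (δ i) : ℕ) * d.vec.2

/-- The configuration after `t` steps. -/
noncomputable def conf (B : Board) (d : Dir) (lab : ι → Option Λ) (x y : ι → ℤ) (δ : ι → ℕ)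
    (t : ℕ) : Config Λ := ofFamily B lab (px d x δ t) (py d y δ t)

/-- Distinct tiles are never at the same location. -/
lemma inj_at (M : Motion B G d lab x y δ) (t : ℕ) (i j : ι) (hi : (lab i).isSome)
    (hj : (lab j).isSome) (h1 : px d x δ t i = px d x δ t j) (h2 : py d y δ t i = py d y δ t j) :
    i = j := by
  unfold px at h1
  unfold py at h2
  rcases lt_trichotomy (min t (δ i)) (min t (δ j)) with h | h | h
  · have := M.line j i hj hi (min t (δ j) - min t (δ i)) (by omega)
      (by push_cast [Nat.cast_sub h.le] at *; linarith)
      (by push_cast [Nat.cast_sub h.le] at *; linarith)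
    omega
  · rw [h] at h1 h2
    exact M.inj i j hi hj (by linarith) (by linarith)
  · have := M.line i j hi hj (min t (δ i) - min t (δ j)) (by omega)
      (by push_cast [Nat.cast_sub h.le] at *; linarith)
      (by push_cast [Nat.cast_sub h.le] at *; linarith)
    omega

lemma label_iff (M : Motion B G d lab x y δ) (t : ℕ) (c : Cell) (a : Λ) :
    (conf B d lab x y δ t).label c = some a ↔
      c ∈ B.opn ∧ ∃ i, lab i = some a ∧ (px d x δ t i, py d y δ t i) = c :=
  ofFamily_label (fun i j hi hj _ => M.inj_at t i j hi hj) c a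

lemma next_pos {t : ℕ} {i : ι} (h : t < δ i) :
    (px d x δ (t + 1) i, py d y δ (t + 1) i) = (px d x δ t i, py d y δ t i) + d.vec := by
  have e1 : min (t + 1) (δ i) = t + 1 := by omega
  have e2 : min t (δ i) = t := by omega
  simp only [px, py, e1, e2, Prod.ext_iff, Prod.fst_add, Prod.snd_add]
  push_cast
  constructor <;> ring

lemma same_pos {t : ℕ} {i : ι} (h : δ i ≤ t) :
    (px d x δ (t + 1) i, py d y δ (t + 1) i) = (px d x δ t i, py d y δ t i) := by
  have e1 : min (t + 1) (δ i) = δ i := by omega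
  have e2 : min t (δ i) = δ i := by omega
  simp only [px, py, e1, e2]

/-- A tile behind a stopped tile is stopped. -/
lemma stopped_behind (M : Motion B G d lab x y δ) {t : ℕ} {i j : ι} (hi : (lab i).isSome)
    (hj : (lab j).isSome) (hjt : δ j ≤ t)
    (h : (px d x δ t j, py d y δ t j) = (px d x δ t i, py d y δ t i) + d.vec) : δ i ≤ t := by
  by_contra hlt
  push Not at hlt
  have e1 : min t (δ j) = δ j := by omega
  have e2 : min t (δ i) = t := by omega
  simp only [px, py, e1, e2, Prod.ext_iff, Prod.fst_add, Prod.snd_add] at h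
  have := M.line i j hi hj (t + 1 - δ j) (by omega)
    (by push_cast [Nat.cast_sub (show δ j ≤ t + 1 by omega)]; linarith [h.1])
    (by push_cast [Nat.cast_sub (show δ j ≤ t + 1 by omega)]; linarith [h.2])
  omega

lemma region_of_opn {c : Cell} (h : c ∈ B.opn) : c ∈ B.region := B.opn_subset h

/-- A stopped tile is at its last position. -/
lemma pos_stopped {t : ℕ} {i : ι} (h : δ i ≤ t) :
    px d x δ t i = x i + δ i * d.vec.1 ∧ py d y δ t i = y i + δ i * d.vec.2 := by
  have e : min t (δ i) = δ i := by omega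
  simp only [px, py, e, and_self]

lemma pos_moving {t : ℕ} {i : ι} (h : t < δ i) :
    px d x δ t i = x i + t * d.vec.1 ∧ py d y δ t i = y i + t * d.vec.2 := by
  have e : min t (δ i) = t := by omega
  simp only [px, py, e, and_self]

/-- What a stopped tile leans on. -/
lemma support (M : Motion B G d lab x y δ) {t : ℕ} {i : ι} (hi : (lab i).isSome) (hit : δ i ≤ t)
    (hc : (px d x δ t i, py d y δ t i) ∈ B.opn) :
    (px d x δ t i, py d y δ t i) + d.vec ∈ B.blocked ∨
    (px d x δ t i, py d y δ t i) + d.vec ∈ B.opn ∧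
      ∃ j, (lab j).isSome ∧ δ j ≤ t ∧
        (px d x δ t j, py d y δ t j) = (px d x δ t i, py d y δ t i) + d.vec := by
  obtain ⟨e1, e2⟩ := pos_stopped (d := d) (x := x) (y := y) hit
  have e3 : (px d x δ t i, py d y δ t i) + d.vec =
      (x i + (δ i + 1) * d.vec.1, y i + (δ i + 1) * d.vec.2) := by
    rw [e1, e2, Prod.ext_iff, Prod.fst_add, Prod.snd_add]
    constructor <;> ring
  rw [e3]
  rw [e1, e2] at hc
  rcases M.rest i hi (region_of_opn hc) with h | ⟨h, j, hj, h1, h2, h3⟩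
  · exact Or.inl h
  · obtain ⟨f1, f2⟩ := pos_stopped (d := d) (x := x) (y := y) (h3.trans hit)
    exact Or.inr ⟨h, j, hj, h3.trans hit, by rw [f1, f2, h1, h2]⟩

/-- If the stopped tile is ahead, it blocks the other one. If it is behind, whatever it leans on is
the other tile, which is therefore stopped. Side by side, this is the field `side`. -/
lemma bond_stopped (M : Motion B G d lab x y δ) {t : ℕ} {i j : ι} {a b : Λ} (hi : lab i = some a)
    (hj : lab j = some b) (hab : Sticks G a b)
    (hco : (px d x δ t j, py d y δ t j) ∈ B.opn) (hci : (px d x δ t i, py d y δ t i) ∈ B.opn)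
    (h : Adjacent (px d x δ t i, py d y δ t i) (px d x δ t j, py d y δ t j)) (hjt : δ j ≤ t) :
    δ i ≤ t := by
  have his : (lab i).isSome := by simp [hi]
  have hjs : (lab j).isSome := by simp [hj]
  rcases h.cases d with h | h | h | h
  · exact M.stopped_behind his hjs hjt h
  · rcases M.support hjs hjt hco with h' | ⟨-, j', hj', hjt', h'⟩
    · rw [← h] at h'
      exact absurd hci h'.2
    · rw [← h, Prod.mk.injEq] at h'
      rw [← M.inj_at t j' i hj' his h'.1 h'.2]
      exact hjt'
  · have := M.side i j a b hi hj hab t h.1 h.2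
    omega
  · have := M.side j i b a hj hi hab.symm t h.1 h.2
    omega

/-- Stuckness is inductive, so each rule is checked: a moving tile never has a blocked location
ahead, a tile behind a stopped one is stopped, and `bond_stopped` carries stopping along a path of
bonds. -/
lemma stopped_of_stuck (M : Motion B G d lab x y δ) {t : ℕ} {c : Cell}
    (h : Stuck G (conf B d lab x y δ t) d c) :
    ∃ i, (lab i).isSome ∧ (px d x δ t i, py d y δ t i) = c ∧ c ∈ B.opn ∧ δ i ≤ t := by
  induction h with
  | wall p hp hb =>
    obtain ⟨a, ha⟩ := hp
    obtain ⟨hc, i, hi, hic⟩ := (M.label_iff t p a).1 ha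
    have his : (lab i).isSome := by simp [hi]
    refine ⟨i, his, hic, hc, ?_⟩
    by_contra hlt
    push Not at hlt
    rw [← hic, ← next_pos hlt] at hb
    change _ ∈ B.blocked at hb
    rcases Nat.lt_or_ge (t + 1) (δ i) with h1 | h1
    · obtain ⟨e1, e2⟩ := pos_moving (d := d) (x := x) (y := y) h1
      rw [e1, e2] at hb
      exact hb.2 (M.opn i his _ h1)
    · obtain ⟨e1, e2⟩ := pos_stopped (d := d) (x := x) (y := y) h1
      rw [e1, e2] at hb
      exact hb.2 (M.last i his hb.1)
  | push p hp _ ih =>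
    obtain ⟨a, ha⟩ := hp
    obtain ⟨hc, i, hi, hic⟩ := (M.label_iff t p a).1 ha
    obtain ⟨j, hj, hjc, -, hjt⟩ := ih
    have his : (lab i).isSome := by simp [hi]
    exact ⟨i, his, hic, hc, M.stopped_behind his hj hjt (by rw [hjc, hic])⟩
  | rigid p q hr _ ih =>
    obtain ⟨w⟩ := hr
    induction w with
    | nil => exact ih
    | cons hadj _ ihw =>
      obtain ⟨j, hj, hjc, hjo, hjt⟩ := ihw (by assumption) ih
      obtain ⟨hadj, a, b, ha, hb, hab⟩ := hadj
      obtain ⟨hc, i, hi, hic⟩ := (M.label_iff t _ a).1 ha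
      obtain ⟨hc', j', hj', hjc'⟩ := (M.label_iff t _ b).1 hb
      have e : j' = j := by
        have e := hjc'.trans hjc.symm
        rw [Prod.mk.injEq] at e
        exact M.inj_at t j' j (by simp [hj']) hj e.1 e.2
      subst e
      exact ⟨i, by simp [hi], hic, hc, M.bond_stopped hi hj' hab (by rwa [hjc']) (by rwa [hic])
        (by rwa [hjc', hic]) hjt⟩

lemma occupied (M : Motion B G d lab x y δ) {t : ℕ} {i : ι} (hi : (lab i).isSome)
    (hc : (px d x δ t i, py d y δ t i) ∈ B.opn) :
    (conf B d lab x y δ t).Occupied (px d x δ t i, py d y δ t i) := by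
  obtain ⟨a, ha⟩ := Option.isSome_iff_exists.1 hi
  exact ⟨a, (M.label_iff t _ a).2 ⟨hc, i, ha, rfl⟩⟩

/-- Bounds the chain of supports in direction `d`, which makes the induction in `stuck_of_stopped`
terminate. -/
lemma exists_add_notMem (B : Board) (d : Dir) (c : Cell) :
    ∃ n : ℕ, c + (n * d.vec.1, n * d.vec.2) ∉ B.region := by
  refine ⟨c.1.natAbs + c.2.natAbs + B.m + B.n + 1, ?_⟩
  simp only [Board.region, box, Set.mem_ofPred_eq, Prod.fst_add, Prod.snd_add]
  cases d <;> simp only [Dir.vec, mul_zero, mul_one, mul_neg, Nat.cast_add, Nat.cast_one] <;> omega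

/-- A stopped tile leans on a wall or on another stopped tile further in direction `d`. Since the
board is finite, following the supports ends at a wall. -/
lemma stuck_of_stopped (M : Motion B G d lab x y δ) {t : ℕ} {i : ι} (hi : (lab i).isSome)
    (hit : δ i ≤ t) (hc : (px d x δ t i, py d y δ t i) ∈ B.opn) :
    Stuck G (conf B d lab x y δ t) d (px d x δ t i, py d y δ t i) := by
  obtain ⟨n, hn⟩ := exists_add_notMem B d (px d x δ t i, py d y δ t i)
  induction n generalizing i with
  | zero => exact absurd (region_of_opn hc) (by simpa using hn)
  | succ n ih =>
    rcases M.support hi hit hc with h | ⟨h, j, hj, hjt, h'⟩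
    · exact Stuck.wall _ (M.occupied hi hc) h
    · refine Stuck.push _ (M.occupied hi hc) ?_
      rw [← h'] at h ⊢
      refine ih hj hjt h ?_
      rw [h']
      convert hn using 2
      simp only [Prod.ext_iff, Prod.fst_add, Prod.snd_add]
      push_cast
      constructor <;> ring

lemma stuck_iff (M : Motion B G d lab x y δ) {t : ℕ} {i : ι} (hi : (lab i).isSome)
    (hc : (px d x δ t i, py d y δ t i) ∈ B.opn) :
    Stuck G (conf B d lab x y δ t) d (px d x δ t i, py d y δ t i) ↔ δ i ≤ t := by
  refine ⟨fun h => ?_, fun h => M.stuck_of_stopped hi h hc⟩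
  obtain ⟨j, hj, hjc, -, hjt⟩ := M.stopped_of_stuck h
  rw [Prod.mk.injEq] at hjc
  rwa [← M.inj_at t j i hj hi hjc.1 hjc.2]

lemma next_notMem (M : Motion B G d lab x y δ) {t : ℕ} {i : ι} (hi : (lab i).isSome)
    (hit : t < δ i) (h : (px d x δ t i, py d y δ t i) + d.vec ∉ B.region) :
    δ i = t + 1 ∧ (x i + δ i * d.vec.1, y i + δ i * d.vec.2) ∉ B.region := by
  rw [← next_pos hit] at h
  rcases Nat.lt_or_ge (t + 1) (δ i) with h1 | h1
  · obtain ⟨e1, e2⟩ := pos_moving (d := d) (x := x) (y := y) h1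
    rw [e1, e2] at h
    exact absurd (region_of_opn (M.opn i hi _ h1)) h
  · obtain ⟨e1, e2⟩ := pos_stopped (d := d) (x := x) (y := y) h1
    rw [e1, e2] at h
    exact ⟨by omega, h⟩

/-- A tile that leaves the board has no bonds while it moves, by the field `exit`. So a polyomino
with a leaving tile is that single tile. -/
lemma exits_iff (M : Motion B G d lab x y δ) {t : ℕ} {i : ι} (hi : (lab i).isSome)
    (hit : t < δ i) (hc : (px d x δ t i, py d y δ t i) ∈ B.opn) :
    Exits G (conf B d lab x y δ t) d (px d x δ t i, py d y δ t i) ↔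
      (px d x δ t i, py d y δ t i) + d.vec ∉ B.region := by
  refine ⟨?_, fun h => ⟨_, SimpleGraph.Reachable.refl _, h⟩⟩
  rintro ⟨q, hr, hq⟩
  change _ ∉ B.region at hq
  obtain ⟨w⟩ := hr.symm
  cases w with
  | nil => exact hq
  | cons hadj w =>
    obtain ⟨hadj, a, b, ha, hb, hab⟩ := hadj
    obtain ⟨hcj, j, hj, hjc⟩ := (M.label_iff t q a).1 ha
    obtain ⟨hcj', j', hj', hjc'⟩ := (M.label_iff t _ b).1 hb
    have hjs : (lab j).isSome := by simp [hj]
    have hjt : t < δ j := by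
      by_contra hle
      push Not at hle
      have := (M.stuck_iff hi hc).1 (Stuck.rigid _ _ hr
        (hjc ▸ M.stuck_of_stopped hjs hle (by rwa [hjc])))
      omega
    subst hjc
    obtain ⟨h1, h2⟩ := M.next_notMem hjs hjt hq
    obtain ⟨e1, e2⟩ := pos_moving (d := d) (x := x) (y := y) hjt
    rw [e1, e2, ← hjc'] at hadj
    exact absurd hadj (M.exit j a hj h2 j' b hj' hab t hjt)

/-- By `stuck_iff` the stuck tiles are exactly those with `δ i ≤ t`. The others advance, and a tile
that leaves gets a position off the open locations, where `ofFamily` ignores it. -/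
lemma step_conf (M : Motion B G d lab x y δ) (t : ℕ) :
    step G d (conf B d lab x y δ t) = conf B d lab x y δ (t + 1) := by
  have key : ∀ c a, (conf B d lab x y δ t).stepLabel G d c = some a ↔
      (conf B d lab x y δ (t + 1)).label c = some a := by
    intro c a
    rw [M.label_iff]
    unfold stepLabel
    split_ifs with h1 h2
    · rw [M.label_iff]
      obtain ⟨j, hj, hjc, hco, hjt⟩ := M.stopped_of_stuck h1
      constructor
      · rintro ⟨-, i, hi, hic⟩
        have e := hic.trans hjc.symm
        rw [Prod.mk.injEq] at e
        have e := M.inj_at t i j (by simp [hi]) hj e.1 e.2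
        subst e
        exact ⟨hco, i, hi, by rw [same_pos hjt, hjc]⟩
      · rintro ⟨-, i, hi, hic⟩
        have e := hic.trans (hjc.symm.trans (same_pos (d := d) (x := x) (y := y) hjt).symm)
        rw [Prod.mk.injEq] at e
        have e := M.inj_at (t + 1) i j (by simp [hi]) hj e.1 e.2
        subst e
        exact ⟨hco, i, hi, hjc⟩
    · obtain ⟨⟨b, hb⟩, h3, h4⟩ := h2
      obtain ⟨hco, i, hi, hic⟩ := (M.label_iff t _ b).1 hb
      have his : (lab i).isSome := by simp [hi]
      rw [← hic] at h3 h4 hco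
      have hit : t < δ i := by
        have := mt (M.stuck_of_stopped his · hco) h3
        omega
      rw [M.exits_iff his hit hco] at h4
      have hic' : (px d x δ t i, py d y δ t i) + d.vec = c := by rw [hic, sub_add_cancel]
      rw [← next_pos hit] at hic' h4
      have hcc : c ∈ B.opn := by
        rw [← hic']
        push Not at h4
        rcases Nat.lt_or_ge (t + 1) (δ i) with h1 | h1
        · obtain ⟨e1, e2⟩ := pos_moving (d := d) (x := x) (y := y) h1
          rw [e1, e2]
          exact M.opn i his _ h1
        · obtain ⟨e1, e2⟩ := pos_stopped (d := d) (x := x) (y := y) h1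
          rw [e1, e2] at h4 ⊢
          exact M.last i his h4
      rw [hb, ← hi]
      constructor
      · intro h; exact ⟨hcc, i, h, hic'⟩
      · rintro ⟨-, j, hj, hjc⟩
        have e := hic'.trans hjc.symm
        rw [Prod.mk.injEq] at e
        rw [M.inj_at (t + 1) i j his (by simp [hj]) e.1 e.2]
        exact hj
    · refine iff_of_false (by simp) ?_
      rintro ⟨hcc, i, hi, hic⟩
      have his : (lab i).isSome := by simp [hi]
      rcases Nat.lt_or_ge t (δ i) with hit | hit
      · have e := next_pos (d := d) (x := x) (y := y) hit
        rw [hic] at e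
        have e' : c - d.vec = (px d x δ t i, py d y δ t i) := by rw [e, add_sub_cancel_right]
        have hco : (px d x δ t i, py d y δ t i) ∈ B.opn := by
          obtain ⟨e1, e2⟩ := pos_moving (d := d) (x := x) (y := y) hit
          rw [e1, e2]
          exact M.opn i his _ hit
        rw [e'] at h2
        refine h2 ⟨M.occupied his hco, ?_, ?_⟩
        · rw [M.stuck_iff his hco]; omega
        · rw [M.exits_iff his hit hco, ← e]
          exact fun h => h (region_of_opn hcc)
      · rw [same_pos hit] at hic
        subst hic
        exact h1 (M.stuck_of_stopped his hit hcc)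
  ext1
  · rfl
  · funext c
    exact Option.ext fun a => key c a

/-- A certified motion is a tilt. -/
theorem tilt (M : Motion B G d lab x y δ) (T : ℕ) (hT : ∀ i, (lab i).isSome → δ i ≤ T) :
    Tilt G d (ofFamily B lab x y)
      (ofFamily B lab (fun i => x i + δ i * d.vec.1) (fun i => y i + δ i * d.vec.2)) := by
  have h0 : ofFamily B lab x y = conf B d lab x y δ 0 := by
    have e1 : px d x δ 0 = x := by funext i; simp [px]
    have e2 : py d y δ 0 = y := by funext i; simp [py]
    rw [conf, e1, e2]
  have hit : ∀ t, (step G d)^[t] (conf B d lab x y δ 0) = conf B d lab x y δ t := by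
    intro t
    induction t with
    | zero => rfl
    | succ t ih => rw [Function.iterate_succ_apply', ih, M.step_conf]
  have hend : ∀ t, T ≤ t → conf B d lab x y δ t =
      ofFamily B lab (fun i => x i + δ i * d.vec.1) (fun i => y i + δ i * d.vec.2) := by
    intro t ht
    refine ofFamily_congr (fun i a hi _ => ⟨i, hi, ?_⟩) (fun i a hi => ⟨i, hi, ?_⟩)
    all_goals
      obtain ⟨e1, e2⟩ := pos_stopped (d := d) (x := x) (y := y)
        ((hT i (by simp [hi])).trans ht)
      simp only [e1, e2, and_self]
  refine ⟨T, ?_, ?_⟩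
  · rw [h0, hit, hend T le_rfl]
  · rw [← hend T le_rfl, Terminal, M.step_conf, hend _ le_rfl, hend _ (Nat.le_succ T)]

end Motion

end Config

/-! ### The board -/

/-- The open locations of the machine, from the bottom to the top: a pit of width `a` for the
rows that are finished, a tube in which a row is collected, with an entrance at its middle, a
corridor with an exit to the west, a shaft, a corridor for a queue, and columns of pockets. -/
def OpenAt (a b L : ℕ) (x y : ℤ) : Prop :=
  (2 ≤ x ∧ x ≤ a + 1 ∧ 2 ≤ y ∧ y ≤ b + 2) ∨
  (2 ≤ x ∧ x ≤ 3 * L + 1 + a ∧ y = b + 3) ∨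
  (x = 3 * L + 1 ∧ y = b + 4) ∨
  (1 ≤ x ∧ x ≤ 3 * L + 1 ∧ y = b + 5) ∨
  (x = 3 * L ∧ y = b + 6) ∨
  (2 ≤ x ∧ x ≤ 3 * L ∧ y = b + 7) ∨
  (2 ≤ x ∧ x ≤ 3 * L ∧ b + 8 ≤ y ∧ x % 3 = 2 ∧ (y - b) % 4 ≠ 2) ∨
  (2 ≤ x ∧ x ≤ 3 * L ∧ b + 8 ≤ y ∧ x % 3 = 0 ∧ (y - b) % 4 ≠ 0)

/-- The board of the machine. -/
def machineBoard (a b L : ℕ) : Board where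
  m := 3 * L + a + 2
  n := 5 * b + 9
  opn := {c | c ∈ box (3 * L + a + 2) (5 * b + 9) ∧ OpenAt a b L c.1 c.2}
  opn_subset := fun _ h => h.1

lemma mem_machine_region {a b L : ℕ} {x y : ℤ} : (x, y) ∈ (machineBoard a b L).region ↔
    1 ≤ x ∧ x ≤ 3 * L + a + 2 ∧ 1 ≤ y ∧ y ≤ 5 * b + 9 := by
  simp [Board.region, machineBoard, box]

lemma mem_machine_opn {a b L : ℕ} {x y : ℤ} : (x, y) ∈ (machineBoard a b L).opn ↔
    (1 ≤ x ∧ x ≤ 3 * L + a + 2 ∧ 1 ≤ y ∧ y ≤ 5 * b + 9) ∧ OpenAt a b L x y := by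
  simp [machineBoard, box]

lemma mem_machine_blocked {a b L : ℕ} {x y : ℤ} : (x, y) ∈ (machineBoard a b L).blocked ↔
    (1 ≤ x ∧ x ≤ 3 * L + a + 2 ∧ 1 ≤ y ∧ y ≤ 5 * b + 9) ∧ ¬ OpenAt a b L x y := by
  rw [Board.blocked, Set.mem_sdiff, mem_machine_region, mem_machine_opn]
  tauto

lemma openAt_low {a b L : ℕ} {x y : ℤ} (hy : y ≤ b + 2) :
    OpenAt a b L x y ↔ 2 ≤ x ∧ x ≤ a + 1 ∧ 2 ≤ y := by
  unfold OpenAt; omega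

lemma openAt_tube {a b L : ℕ} {x y : ℤ} (hy : y = b + 3) :
    OpenAt a b L x y ↔ 2 ≤ x ∧ x ≤ 3 * L + 1 + a := by
  unfold OpenAt; omega

lemma openAt_entrance {a b L : ℕ} {x y : ℤ} (hy : y = b + 4) :
    OpenAt a b L x y ↔ x = 3 * L + 1 := by
  unfold OpenAt; omega

lemma openAt_mid {a b L : ℕ} {x y : ℤ} (hy : y = b + 5) :
    OpenAt a b L x y ↔ 1 ≤ x ∧ x ≤ 3 * L + 1 := by
  unfold OpenAt; omega

lemma openAt_shaft {a b L : ℕ} {x y : ℤ} (hy : y = b + 6) :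
    OpenAt a b L x y ↔ x = 3 * L := by
  unfold OpenAt; omega

lemma openAt_queue {a b L : ℕ} {x y : ℤ} (hy : y = b + 7) :
    OpenAt a b L x y ↔ 2 ≤ x ∧ x ≤ 3 * L := by
  unfold OpenAt; omega

/-- This is the escapement. In the columns `x % 3 = 0`, reached by a tilt east, height 0 modulo 4
above `b` is blocked, so falling tiles rest at height 1. In the columns `x % 3 = 2`, reached by a
tilt west, height 2 is blocked, so they rest at height 3. Alternating the columns lowers a layer by
two units at a time. -/
lemma openAt_pocket {a b L : ℕ} {x y : ℤ} (hy : b + 8 ≤ y) :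
    OpenAt a b L x y ↔ (2 ≤ x ∧ x ≤ 3 * L) ∧ (x % 3 = 2 ∧ (y - b) % 4 ≠ 2 ∨ x % 3 = 0 ∧ (y - b) % 4 ≠ 0) := by
  unfold OpenAt; omega

/-! ### States of the machine -/

/-- The places of the tiles of the machine. -/
inductive Slot where
  | pocket (r m : ℕ)
  | queue (m : ℕ)
  | mid
  | tube (n : ℕ)
  | pit (i j : ℕ)

/-- A state of the machine: there are `layers` layers `lay r` of tiles in pockets, which are
shifted by `(u, v)`; the queue `q` with abscissas `xq`, at most one tile `mid` in the middle
corridor, at `xm`, the collected tiles `t` with abscissas `xt`, and `rows` finished rows `row i`. -/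
structure Stage (Λ : Type) where
  layers : ℕ
  lay : ℕ → ℕ → Λ
  u : ℤ
  v : ℤ
  q : List Λ
  xq : ℕ → ℤ
  mid : Option Λ
  xm : ℤ
  t : List Λ
  xt : ℕ → ℤ
  rows : ℕ
  row : ℕ → ℕ → Λ

namespace Stage

variable {Λ : Type}

/-- The label of the tile in a slot. -/
def lab (a L : ℕ) (s : Stage Λ) : Slot → Option Λ
  | .pocket r m => if r < s.layers ∧ m < L then some (s.lay r m) else none
  | .queue m => s.q[m]?
  | .mid => s.mid
  | .tube n => s.t[n]?
  | .pit i j => if i < s.rows ∧ j < a then some (s.row i j) else none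

/-- The abscissa of a slot. -/
def abs (a L : ℕ) (s : Stage Λ) : Slot → ℤ
  | .pocket _ m => 3 * (L - m) - 1 + s.u
  | .queue m => s.xq m
  | .mid => s.xm
  | .tube n => s.xt n
  | .pit _ j => a + 1 - j

/-- The ordinate of a slot. -/
def ord (b : ℕ) (s : Stage Λ) : Slot → ℤ
  | .pocket r _ => b + 9 + 4 * r + s.v
  | .queue _ => b + 7
  | .mid => b + 5
  | .tube _ => b + 3
  | .pit i _ => 2 + i

/-- The configuration of a state of the machine. -/
noncomputable def conf (a b L : ℕ) (s : Stage Λ) : Config Λ :=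
  Config.ofFamily (machineBoard a b L) (s.lab a L) (s.abs a L) (s.ord b)

variable {a b L : ℕ} {s : Stage Λ}

@[simp] lemma lab_pocket_isSome {r m : ℕ} :
    (s.lab a L (.pocket r m)).isSome ↔ r < s.layers ∧ m < L := by
  simp only [lab]; split_ifs <;> simp_all

@[simp] lemma lab_queue_isSome {m : ℕ} : (s.lab a L (.queue m)).isSome ↔ m < s.q.length := by
  simp [lab]

@[simp] lemma lab_mid_isSome : (s.lab a L .mid).isSome ↔ s.mid.isSome := Iff.rfl

@[simp] lemma lab_tube_isSome {n : ℕ} : (s.lab a L (.tube n)).isSome ↔ n < s.t.length := by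
  simp [lab]

@[simp] lemma lab_pit_isSome {i j : ℕ} :
    (s.lab a L (.pit i j)).isSome ↔ i < s.rows ∧ j < a := by
  simp only [lab]; split_ifs <;> simp_all

/-- What a state satisfies between the tilts. -/
structure Valid (a b L : ℕ) (s : Stage Λ) : Prop where
  layers_le : s.layers ≤ b
  u_mem : s.u = 0 ∨ s.u = 1
  v_mem : s.v = 0 ∨ s.v = 2
  q_anti : ∀ m m', m < m' → m' < s.q.length → s.xq m' < s.xq m
  q_lo : ∀ m, m < s.q.length → 2 + (s.q.length - 1 - m) ≤ s.xq m
  q_hi : ∀ m, m < s.q.length → s.xq m ≤ 3 * L - m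
  t_anti : ∀ m m', m < m' → m' < s.t.length → s.xt m' < s.xt m
  t_lo : ∀ m, m < s.t.length → 2 + (s.t.length - 1 - m) ≤ s.xt m
  t_hi : ∀ m, m < s.t.length → s.xt m ≤ 3 * L + 1 + a - m
  rows_le : s.rows ≤ b

/-! ### Tilts to the east and to the west -/

/-- The number of steps of the tiles in a tilt to the east. -/
def stepsE (a L : ℕ) (s : Stage Λ) : Slot → ℕ
  | .pocket _ _ => (1 - s.u).toNat
  | .queue m => (3 * L - m - s.xq m).toNat
  | .mid => 1
  | .tube n => (3 * L + 1 + a - n - s.xt n).toNat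
  | .pit _ _ => 0

/-- The state after a tilt to the east. -/
def east (a L : ℕ) (s : Stage Λ) : Stage Λ :=
  { s with
    u := 1
    xq := fun m => 3 * L - m
    xm := 3 * L + 1
    xt := fun n => 3 * L + 1 + a - n }

lemma Valid.inj (hs : s.Valid a b L) (i j : Slot) (hi : (s.lab a L i).isSome)
    (hj : (s.lab a L j).isSome) (e1 : s.abs a L i = s.abs a L j) (e2 : s.ord b i = s.ord b j) :
    i = j := by
  obtain ⟨h1, h2, h3, h4, h5, h6, h7, h8, h9, h10⟩ := hs
  rcases i with ⟨r, m⟩ | m | _ | n | ⟨i₀, j₀⟩ <;> rcases j with ⟨r', m'⟩ | m' | _ | n' | ⟨i', j'⟩ <;>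
    simp only [abs, ord, lab_pocket_isSome, lab_queue_isSome, lab_mid_isSome,
      lab_tube_isSome, lab_pit_isSome] at hi hj e1 e2 <;>
    (try simp only [Slot.pocket.injEq, Slot.queue.injEq, Slot.tube.injEq, Slot.pit.injEq]) <;>
    try omega
  · rcases lt_trichotomy m m' with h | h | h
    · have := h4 m m' h hj
      omega
    · exact h
    · have := h4 m' m h hi
      omega
  · rcases lt_trichotomy n n' with h | h | h
    · have := h7 n n' h hj
      omega
    · exact h
    · have := h7 n' n h hi
      omega

/-- Vertically adjacent tiles are finished. -/
lemma Valid.eq_pit (hs : s.Valid a b L) {i j : Slot} (hi : (s.lab a L i).isSome)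
    (hj : (s.lab a L j).isSome) (e : s.ord b j = s.ord b i + 1 ∨ s.ord b j = s.ord b i - 1) :
    ∃ r m r' m', i = .pit r m ∧ j = .pit r' m' := by
  obtain ⟨h1, h2, h3, h4, h5, h6, h7, h8, h9, h10⟩ := hs
  rcases i with ⟨r, m⟩ | m | _ | n | ⟨i₀, j₀⟩ <;> rcases j with ⟨r', m'⟩ | m' | _ | n' | ⟨i', j'⟩ <;>
    simp only [ord, lab_pocket_isSome, lab_queue_isSome, lab_mid_isSome,
      lab_tube_isSome, lab_pit_isSome] at hi hj e <;>
    first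
    | omega
    | exact ⟨_, _, _, _, rfl, rfl⟩

/-- Tiles slide only along their own rows. Different kinds of tiles lie in rows at least two apart,
so bonds across rows occur only inside the pit, where nothing moves. Queue and tube get packed
against the wall, each tile leaning on its predecessor. -/
lemma motion_east (G : Λ → Λ → Bool) (hs : s.Valid a b L) (haL : a ≤ L) (ha : 0 < a)
    (hm : s.mid.isSome → s.xm = 3 * L) :
    Config.Motion (machineBoard a b L) G .E (s.lab a L) (s.abs a L) (s.ord b)
      (s.stepsE a L) := by
  have inj := hs.inj
  have adj := fun i j => hs.eq_pit (i := i) (j := j)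
  obtain ⟨h1, h2, h3, h4, h5, h6, h7, h8, h9, h10⟩ := hs
  have opn : ∀ i, (s.lab a L i).isSome → ∀ t : ℕ, t ≤ s.stepsE a L i →
      (s.abs a L i + t, s.ord b i) ∈ (machineBoard a b L).opn := by
    rintro (⟨r, m⟩ | m | _ | n | ⟨i, j⟩) hi t ht <;>
      simp only [abs, ord, lab_pocket_isSome, lab_queue_isSome, lab_mid_isSome,
        lab_tube_isSome, lab_pit_isSome, stepsE, mem_machine_opn] at hi ht ⊢
    · rw [openAt_pocket (by omega)]
      omega
    · have := h5 m hi
      have := h6 m hi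
      rw [openAt_queue (by omega)]
      omega
    · have := hm hi
      rw [openAt_mid (by omega)]
      omega
    · have := h8 n hi
      have := h9 n hi
      rw [openAt_tube (by omega)]
      omega
    · rw [openAt_low (by omega)]
      omega
  refine ⟨inj, ?_, ?_, ?_, ?_, ?_, ?_⟩ <;> simp only [Dir.vec, mul_one, mul_zero, add_zero]
  · exact fun i hi t ht => opn i hi t ht.le
  · exact fun i hi _ => opn i hi _ le_rfl
  · rintro (⟨r, m⟩ | m | _ | n | ⟨i, j⟩) (⟨r', m'⟩ | m' | _ | n' | ⟨i', j'⟩) hi hj p hp e1 e2 <;>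
      simp only [abs, ord, lab_pocket_isSome, lab_queue_isSome, lab_mid_isSome,
        lab_tube_isSome, lab_pit_isSome, stepsE] at hi hj e1 e2 ⊢ <;>
      try omega
    · have := h6 m hi
      have := h6 m' hj
      rcases lt_or_ge m m' with h | h
      · have := h4 m m' h hj
        omega
      · have : m ≠ m' := by
          rintro rfl
          omega
        omega
    · have := h9 n hi
      have := h9 n' hj
      rcases lt_or_ge n n' with h | h
      · have := h7 n n' h hj
        omega
      · have : n ≠ n' := by
          rintro rfl
          omega
        omega
  · intro i j _ _ hi hj _ t _ e2
    obtain ⟨_, _, _, _, rfl, rfl⟩ := adj i j (by simp [hi]) (by simp [hj]) (Or.inl e2)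
    rfl
  · rintro (⟨r, m⟩ | m | _ | n | ⟨i, j⟩) hi - <;>
      simp only [abs, ord, lab_pocket_isSome, lab_queue_isSome, lab_mid_isSome,
        lab_tube_isSome, lab_pit_isSome, stepsE, mem_machine_blocked] at hi ⊢
    · rw [openAt_pocket (by omega)]
      omega
    · have := h6 m hi
      rcases m with _ | m
      · rw [openAt_queue (by omega)]
        omega
      · have := h6 m (by omega)
        have := h4 m (m + 1) (by omega) hi
        have o := opn (.queue m) (by simp; omega) _ le_rfl
        have e : s.abs a L (.queue m) + (s.stepsE a L (.queue m) : ℕ) =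
            s.xq (m + 1) + ((3 * L - (m + 1 : ℕ) - s.xq (m + 1)).toNat + 1) := by
          simp only [abs, stepsE]
          omega
        rw [e] at o
        exact Or.inr ⟨o, .queue m, by simp; omega, e, rfl, by simp only; omega⟩
    · have := hm hi
      rw [openAt_mid (by omega)]
      omega
    · have := h9 n hi
      rcases n with _ | n
      · rw [openAt_tube (by omega)]
        omega
      · have := h9 n (by omega)
        have := h7 n (n + 1) (by omega) hi
        have o := opn (.tube n) (by simp; omega) _ le_rfl
        have e : s.abs a L (.tube n) + (s.stepsE a L (.tube n) : ℕ) =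
            s.xt (n + 1) + ((3 * L + 1 + a - (n + 1 : ℕ) - s.xt (n + 1)).toNat + 1) := by
          simp only [abs, stepsE]
          omega
        rw [e] at o
        exact Or.inr ⟨o, .tube n, by simp; omega, e, rfl, by simp only; omega⟩
    · rcases j with _ | j
      · rw [openAt_low (by omega)]
        omega
      · have o := opn (.pit i j) (by simp; omega) 0 (by simp)
        have e : s.abs a L (.pit i j) + (0 : ℕ) = a + 1 - (j + 1 : ℕ) + ((0 : ℕ) + 1) := by
          simp only [abs]
          omega
        rw [e] at o
        exact Or.inr ⟨o, .pit i j, by simp; omega, e, rfl, le_rfl⟩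
  · intro i a hi h
    exact absurd (Config.Motion.region_of_opn (opn i (by simp [hi]) _ le_rfl)) h

lemma tilt_east (G : Λ → Λ → Bool) (hs : s.Valid a b L) (haL : a ≤ L) (ha : 0 < a)
    (hm : s.mid.isSome → s.xm = 3 * L) :
    Config.Tilt G .E (s.conf a b L) ((s.east a L).conf a b L) := by
  have H : ∀ i, (s.lab a L i).isSome →
      s.abs a L i + s.stepsE a L i = (s.east a L).abs a L i ∧
        s.stepsE a L i ≤ 3 * L + 1 + a := by
    obtain ⟨h1, h2, h3, h4, h5, h6, h7, h8, h9, h10⟩ := hs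
    rintro (⟨r, m⟩ | m | _ | n | ⟨i, j⟩) hi <;>
      simp only [lab_pocket_isSome, lab_queue_isSome, lab_mid_isSome,
        lab_tube_isSome, lab_pit_isSome] at hi <;>
      simp only [abs, stepsE, east]
    · omega
    · have := h5 m hi
      have := h6 m hi
      omega
    · have := hm hi
      omega
    · have := h8 n hi
      have := h9 n hi
      omega
    · omega
  have hl : ∀ i, (s.east a L).lab a L i = s.lab a L i := by rintro (_ | _ | _ | _ | _) <;> rfl
  have ho : ∀ i, (s.east a L).ord b i = s.ord b i := by rintro (_ | _ | _ | _ | _) <;> rfl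
  have T := (motion_east G hs haL ha hm).tilt (3 * L + 1 + a) fun i hi => (H i hi).2
  simp only [Dir.vec, mul_one, mul_zero, add_zero] at T
  refine Eq.mp (congrArg _ (Config.ofFamily_congr (fun i c hi _ => ⟨i, ?_⟩)
    (fun i c hi => ⟨i, ?_⟩))) T
  · rw [hl]
    exact ⟨hi, (H i (by simp [hi])).1.symm, ho i⟩
  · rw [hl] at hi
    exact ⟨hi, (H i (by simp [hi])).1, (ho i).symm⟩

/-- The number of steps of the tiles in a tilt to the west. -/
def stepsW (s : Stage Λ) : Slot → ℕ
  | .pocket _ _ => s.u.toNat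
  | .queue m => (s.xq m - (2 + (s.q.length - 1 - m))).toNat
  | .mid => s.xm.toNat
  | .tube n => (s.xt n - (2 + (s.t.length - 1 - n))).toNat
  | .pit _ _ => 0

/-- The state after a tilt to the west. -/
def west (s : Stage Λ) : Stage Λ :=
  { s with
    u := 0
    mid := none
    xq := fun m => 2 + (s.q.length - 1 - m)
    xt := fun n => 2 + (s.t.length - 1 - n) }

/-- The mirror image of the tilt to the east, except that the tile in the middle corridor runs out
of the board. It is alone in its row and the neighbouring rows carry no tile, so it drags nothing
along. -/
lemma motion_west (G : Λ → Λ → Bool) (hs : s.Valid a b L) (haL : a ≤ L) (ha : 0 < a)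
    (hm : s.mid.isSome → s.xm = 3 * L) :
    Config.Motion (machineBoard a b L) G .W (s.lab a L) (s.abs a L) (s.ord b) s.stepsW := by
  have inj := hs.inj
  have adj := fun i j => hs.eq_pit (i := i) (j := j)
  obtain ⟨h1, h2, h3, h4, h5, h6, h7, h8, h9, h10⟩ := hs
  have opn : ∀ i, (s.lab a L i).isSome → ∀ t : ℕ, t ≤ s.stepsW i → (i = .mid → t < s.stepsW i) →
      (s.abs a L i + -t, s.ord b i) ∈ (machineBoard a b L).opn := by
    rintro (⟨r, m⟩ | m | _ | n | ⟨i, j⟩) hi t ht hlt <;>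
      simp only [abs, ord, lab_pocket_isSome, lab_queue_isSome, lab_mid_isSome,
        lab_tube_isSome, lab_pit_isSome, stepsW, mem_machine_opn] at hi ht hlt ⊢
    · rw [openAt_pocket (by omega)]
      omega
    · have := h5 m hi
      have := h6 m hi
      rw [openAt_queue (by omega)]
      omega
    · have := hm hi
      have := hlt trivial
      rw [openAt_mid (by omega)]
      omega
    · have := h8 n hi
      have := h9 n hi
      rw [openAt_tube (by omega)]
      omega
    · rw [openAt_low (by omega)]
      omega
  have out : (s.lab a L .mid).isSome →
      (s.abs a L .mid + -(s.stepsW .mid : ℤ), s.ord b .mid) ∉ (machineBoard a b L).region := by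
    intro hi h
    have := hm hi
    simp only [mem_machine_region, abs, stepsW] at h
    omega
  refine ⟨inj, ?_, ?_, ?_, ?_, ?_, ?_⟩ <;>
    simp only [Dir.vec, mul_one, mul_zero, add_zero, mul_neg]
  · exact fun i hi t ht => opn i hi t ht.le fun _ => ht
  · intro i hi h
    refine opn i hi _ le_rfl ?_
    rintro rfl
    exact absurd h (out hi)
  · rintro (⟨r, m⟩ | m | _ | n | ⟨i, j⟩) (⟨r', m'⟩ | m' | _ | n' | ⟨i', j'⟩) hi hj p hp e1 e2 <;>
      simp only [abs, ord, lab_pocket_isSome, lab_queue_isSome, lab_mid_isSome,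
        lab_tube_isSome, lab_pit_isSome, stepsW] at hi hj e1 e2 ⊢ <;>
      try omega
    · have := h5 m hi
      have := h5 m' hj
      rcases lt_or_ge m' m with h | h
      · have := h4 m' m h hi
        omega
      · have : m ≠ m' := by
          rintro rfl
          omega
        omega
    · have := h8 n hi
      have := h8 n' hj
      rcases lt_or_ge n' n with h | h
      · have := h7 n' n h hi
        omega
      · have : n ≠ n' := by
          rintro rfl
          omega
        omega
  · intro i j _ _ hi hj _ t _ e2
    obtain ⟨_, _, _, _, rfl, rfl⟩ := adj i j (by simp [hi]) (by simp [hj]) (Or.inr e2)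
    rfl
  · rintro (⟨r, m⟩ | m | _ | n | ⟨i, j⟩) hi h <;>
      simp only [abs, ord, lab_pocket_isSome, lab_queue_isSome, lab_mid_isSome,
        lab_tube_isSome, lab_pit_isSome, stepsW, mem_machine_blocked] at hi ⊢
    · rw [openAt_pocket (by omega)]
      omega
    · have := h5 m hi
      rcases Nat.lt_or_ge (m + 1) s.q.length with hm' | hm'
      · have := h5 (m + 1) hm'
        have := h4 m (m + 1) (by omega) hm'
        have o := opn (.queue (m + 1)) (by simp; omega) _ le_rfl (by simp)
        have e : s.abs a L (.queue (m + 1)) + -(s.stepsW (.queue (m + 1)) : ℤ) =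
            s.xq m + -((s.xq m - (2 + (s.q.length - 1 - m))).toNat + 1) := by
          simp only [abs, stepsW]
          omega
        rw [e] at o
        exact Or.inr ⟨o, .queue (m + 1), by simp; omega, e, rfl, by simp only; omega⟩
      · rw [openAt_queue (by omega)]
        omega
    · exact absurd h (out hi)
    · have := h8 n hi
      rcases Nat.lt_or_ge (n + 1) s.t.length with hn' | hn'
      · have := h8 (n + 1) hn'
        have := h7 n (n + 1) (by omega) hn'
        have o := opn (.tube (n + 1)) (by simp; omega) _ le_rfl (by simp)
        have e : s.abs a L (.tube (n + 1)) + -(s.stepsW (.tube (n + 1)) : ℤ) =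
            s.xt n + -((s.xt n - (2 + (s.t.length - 1 - n))).toNat + 1) := by
          simp only [abs, stepsW]
          omega
        rw [e] at o
        exact Or.inr ⟨o, .tube (n + 1), by simp; omega, e, rfl, by simp only; omega⟩
      · rw [openAt_tube (by omega)]
        omega
    · rcases Nat.lt_or_ge (j + 1) a with hj | hj
      · have o := opn (.pit i (j + 1)) (by simp; omega) 0 (by simp) (by simp)
        have e : s.abs a L (.pit i (j + 1)) + -((0 : ℕ) : ℤ) = a + 1 - j + -((0 : ℕ) + 1) := by
          simp only [abs]
          omega
        rw [e] at o
        exact Or.inr ⟨o, .pit i (j + 1), by simp; omega, e, rfl, le_rfl⟩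
      · rw [openAt_low (by omega)]
        omega
  · rintro i c hi h j d hj - t ht hadj
    have hi' : (s.lab a L i).isSome := by simp [hi]
    have hj' : (s.lab a L j).isSome := by simp [hj]
    obtain rfl : i = .mid := by
      by_contra hne
      exact h (Config.Motion.region_of_opn (opn i hi' _ le_rfl fun e => absurd e hne))
    -- The rows next to the middle corridor are empty, so any other tile is at vertical distance at
    -- least two.
    have hlt : s.ord b j ≤ s.ord b .mid - 2 ∨ j = .mid ∨ s.ord b .mid + 2 ≤ s.ord b j := by
      rcases j with ⟨r', m'⟩ | m' | _ | n' | ⟨i', j'⟩ <;>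
        first
        | exact Or.inr (Or.inl rfl)
        | simp only [ord, lab_pocket_isSome, lab_queue_isSome,
            lab_tube_isSome, lab_pit_isSome, reduceCtorEq] at hj' ⊢
          omega
    rcases hlt with hlt | rfl | hlt
    · have := abs_nonneg (s.abs a L .mid + -(t : ℤ) -
        (s.abs a L j + -((min t (s.stepsW j) : ℕ) : ℤ)))
      have := le_abs_self (s.ord b .mid - s.ord b j)
      simp only [Adjacent] at hadj
      omega
    · have : min t (s.stepsW .mid) = t := by omega
      simp [Adjacent, this] at hadj
    · have := abs_nonneg (s.abs a L .mid + -(t : ℤ) -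
        (s.abs a L j + -((min t (s.stepsW j) : ℕ) : ℤ)))
      have := neg_le_abs (s.ord b .mid - s.ord b j)
      simp only [Adjacent] at hadj
      omega

lemma tilt_west (G : Λ → Λ → Bool) (hs : s.Valid a b L) (haL : a ≤ L) (ha : 0 < a)
    (hm : s.mid.isSome → s.xm = 3 * L) :
    Config.Tilt G .W (s.conf a b L) (s.west.conf a b L) := by
  have H : ∀ i, (s.lab a L i).isSome →
      (i ≠ .mid → s.abs a L i + -(s.stepsW i : ℤ) = s.west.abs a L i) ∧
        s.stepsW i ≤ 3 * L + 1 + a := by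
    obtain ⟨h1, h2, h3, h4, h5, h6, h7, h8, h9, h10⟩ := hs
    rintro (⟨r, m⟩ | m | _ | n | ⟨i, j⟩) hi <;>
      simp only [lab_pocket_isSome, lab_queue_isSome, lab_mid_isSome,
        lab_tube_isSome, lab_pit_isSome] at hi <;>
      simp only [abs, stepsW, west, ne_eq, reduceCtorEq, not_false_eq_true, true_implies]
    · omega
    · have := h5 m hi
      have := h6 m hi
      omega
    · have := hm hi
      exact ⟨fun h => absurd trivial h, by omega⟩
    · have := h8 n hi
      have := h9 n hi
      omega
    · omega
  have hl : ∀ i, i ≠ .mid → s.west.lab a L i = s.lab a L i := by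
    rintro (_ | _ | _ | _ | _) h <;> first | rfl | exact absurd rfl h
  have ho : ∀ i, s.west.ord b i = s.ord b i := by rintro (_ | _ | _ | _ | _) <;> rfl
  have T := (motion_west G hs haL ha hm).tilt (3 * L + 1 + a) fun i hi => (H i hi).2
  simp only [Dir.vec, mul_one, mul_zero, add_zero, mul_neg] at T
  refine Eq.mp (congrArg _ (Config.ofFamily_congr (fun i c hi hc => ⟨i, ?_⟩)
    (fun i c hi => ⟨i, ?_⟩))) T
  · have hi' : i ≠ .mid := by
      rintro rfl
      have := hm (by simpa [lab] using congrArg Option.isSome hi)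
      simp only [mem_machine_opn, abs, stepsW] at hc
      omega
    rw [hl i hi']
    exact ⟨hi, ((H i (by simp [hi])).1 hi').symm, ho i⟩
  · have hi' : i ≠ .mid := by
      rintro rfl
      simp [lab, west] at hi
    rw [hl i hi'] at hi
    exact ⟨hi, (H i (by simp [hi])).1 hi', (ho i).symm⟩

/-! ### Tilts to the south -/

/-- The number of steps of the tiles in a tilt to the south that releases the head of the queue. -/
def stepsS (s : Stage Λ) : Slot → ℕ
  | .pocket _ _ => s.v.toNat
  | .queue m => if m = 0 then 2 else 0
  | .mid => 2
  | .tube _ => 0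
  | .pit _ _ => 0

/-- The state after a tilt to the south that releases the head of the queue. -/
def south (a L : ℕ) (s : Stage Λ) : Stage Λ :=
  { s with
    v := 0
    q := s.q.tail
    xq := fun m => 3 * L - 1 - m
    mid := s.q.head?
    xm := 3 * L
    t := s.t ++ s.mid.toList
    xt := fun n => if n < s.t.length then 3 * L + 1 + a - n else 3 * L + 1 }

/-- The tiles of the machine are in the positions that a tilt to the east leads to. -/
structure Ready (a b L : ℕ) (s : Stage Λ) : Prop where
  layers_le : s.layers ≤ b
  u_eq : s.u = 1
  v_mem : s.v = 0 ∨ s.v = 2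
  q_length : s.q.length ≤ L
  xq_eq : ∀ m, s.xq m = 3 * L - m
  xm_eq : s.xm = 3 * L + 1
  t_length : s.t.length + s.mid.toList.length ≤ a
  xt_eq : ∀ n, s.xt n = 3 * L + 1 + a - n
  rows_le : s.rows ≤ b

lemma Ready.valid (hs : s.Ready a b L) : s.Valid a b L := by
  obtain ⟨h1, h2, h3, h4, h5, h6, h7, h8, h9⟩ := hs
  refine ⟨h1, Or.inr h2, h3, ?_, ?_, ?_, ?_, ?_, ?_, h9⟩ <;> intros <;> simp only [h5, h8] <;> omega

lemma Ready.valid_south (hs : s.Ready a b L) (haL : a ≤ L) : (s.south a L).Valid a b L := by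
  have hl : s.mid.toList.length ≤ 1 := by cases s.mid <;> simp
  obtain ⟨h1, h2, h3, h4, h5, h6, h7, h8, h9⟩ := hs
  refine ⟨h1, Or.inr h2, Or.inl rfl, ?_, ?_, ?_, ?_, ?_, ?_, h9⟩
  all_goals
    simp only [south, List.length_append, List.length_tail]
    intros
    try split_ifs
    all_goals omega

/-- The head of the queue falls down the shaft while a kept tile falls through the entrance into the
tube. The tube is packed to the east of the pit, since `a ≤ L`, so it has a floor. The layers, in
their eastern columns, drop to height 1 or stay there. -/
lemma motion_south (G : Λ → Λ → Bool) (hs : s.Ready a b L) (haL : a ≤ L) (ha : 0 < a)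
    (hq : ∀ c d, s.q[0]? = some c → s.q[1]? = some d → ¬ Sticks G c d) :
    Config.Motion (machineBoard a b L) G .S (s.lab a L) (s.abs a L) (s.ord b) s.stepsS := by
  have inj := hs.valid.inj
  obtain ⟨h1, h2, h3, h4, h5, h6, h7, h8, h9⟩ := hs
  have hm : s.mid.isSome → s.mid.toList.length = 1 := by
    cases s.mid <;> simp
  have opn : ∀ i, (s.lab a L i).isSome → ∀ t : ℕ, t ≤ s.stepsS i →
      (s.abs a L i, s.ord b i + -t) ∈ (machineBoard a b L).opn := by
    rintro (⟨r, m⟩ | m | _ | n | ⟨i, j⟩) hi t ht <;>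
      simp only [abs, ord, lab_pocket_isSome, lab_queue_isSome, lab_mid_isSome,
        lab_tube_isSome, lab_pit_isSome, stepsS, mem_machine_opn, h5, h6, h8] at hi ht ⊢
    · rw [openAt_pocket (by omega)]
      omega
    · split_ifs at ht with h0
      · obtain rfl | rfl | rfl : t = 0 ∨ t = 1 ∨ t = 2 := by omega
        · rw [openAt_queue (by omega)]
          omega
        · rw [openAt_shaft (by omega)]
          omega
        · rw [openAt_mid (by omega)]
          omega
      · rw [openAt_queue (by omega)]
        omega
    · obtain rfl | rfl | rfl : t = 0 ∨ t = 1 ∨ t = 2 := by omega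
      · rw [openAt_mid (by omega)]
        omega
      · rw [openAt_entrance (by omega)]
        omega
      · rw [openAt_tube (by omega)]
        omega
    · rw [openAt_tube (by omega)]
      omega
    · rw [openAt_low (by omega)]
      omega
  refine ⟨inj, ?_, ?_, ?_, ?_, ?_, ?_⟩ <;>
    simp only [Dir.vec, mul_one, mul_zero, add_zero, mul_neg]
  · exact fun i hi t ht => opn i hi t ht.le
  · exact fun i hi _ => opn i hi _ le_rfl
  · rintro (⟨r, m⟩ | m | _ | n | ⟨i, j⟩) (⟨r', m'⟩ | m' | _ | n' | ⟨i', j'⟩) hi hj p hp e1 e2 <;>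
      simp only [abs, ord, lab_pocket_isSome, lab_queue_isSome, lab_mid_isSome,
        lab_tube_isSome, lab_pit_isSome, stepsS, h5, h6, h8] at hi hj e1 e2 ⊢ <;>
      (try split_ifs) <;> omega
  · intro i j c d hi hj hcd t e1 e2
    have hi' : (s.lab a L i).isSome := by simp [hi]
    have hj' : (s.lab a L j).isSome := by simp [hj]
    -- The head of the queue and its successor are the only neighbours in a row of which one moves
    -- and the other does not.
    by_cases h01 : i = .queue 0 ∧ j = .queue 1
    · obtain ⟨rfl, rfl⟩ := h01
      exact absurd hcd (hq c d hi hj)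
    rcases i with ⟨r, m⟩ | m | _ | n | ⟨i₀, j₀⟩ <;>
      rcases j with ⟨r', m'⟩ | m' | _ | n' | ⟨i', j'⟩ <;>
      simp only [abs, ord, lab_pocket_isSome, lab_queue_isSome, lab_mid_isSome,
        lab_tube_isSome, lab_pit_isSome, stepsS, h5, h6, h8, Slot.queue.injEq] at hi' hj' e1 e2 h01 ⊢ <;>
      (try split_ifs at e2 ⊢) <;> omega
  · rintro (⟨r, m⟩ | m | _ | n | ⟨i, j⟩) hi - <;>
      simp only [abs, ord, lab_pocket_isSome, lab_queue_isSome, lab_mid_isSome,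
        lab_tube_isSome, lab_pit_isSome, stepsS, mem_machine_blocked, h5, h6, h8] at hi ⊢
    · rw [openAt_pocket (by omega)]
      omega
    · split_ifs
      · rw [openAt_entrance (by omega)]
        omega
      · rw [openAt_shaft (by omega)]
        omega
    · rw [openAt_low (by omega)]
      omega
    · rw [openAt_low (by omega)]
      omega
    · rcases i with _ | i
      · rw [openAt_low (by omega)]
        omega
      · have o := opn (.pit i j) (by simp; omega) 0 (by simp)
        have e : s.ord b (.pit i j) + -((0 : ℕ) : ℤ) = 2 + (i + 1 : ℕ) + -((0 : ℕ) + 1) := by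
          simp only [ord]
          omega
        rw [e] at o
        exact Or.inr ⟨o, .pit i j, by simp; omega, rfl, e, le_rfl⟩
  · intro i c hi h
    exact absurd (Config.Motion.region_of_opn (opn i (by simp [hi]) _ le_rfl)) h

lemma tilt_south (G : Λ → Λ → Bool) (hs : s.Ready a b L) (haL : a ≤ L) (ha : 0 < a)
    (hq : ∀ c d, s.q[0]? = some c → s.q[1]? = some d → ¬ Sticks G c d) :
    Config.Tilt G .S (s.conf a b L) ((s.south a L).conf a b L) := by
  have hv : ((s.v.toNat : ℕ) : ℤ) = s.v := by have := hs.v_mem; omega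
  have T := (motion_south G hs haL ha hq).tilt 2 fun i hi => by
    have := hs.v_mem
    rcases i with ⟨r, m⟩ | m | _ | n | ⟨i₀, j₀⟩ <;> simp only [stepsS] <;> (try split_ifs) <;> omega
  obtain ⟨h1, h2, h3, h4, h5, h6, h7, h8, h9⟩ := hs
  simp only [Dir.vec, mul_one, mul_zero, add_zero, mul_neg] at T
  refine Eq.mp (congrArg _ (Config.ofFamily_congr (fun i c hi _ => ?_) (fun i c hi => ?_))) T
  · rcases i with ⟨r, m⟩ | m | _ | n | ⟨i, j⟩
    · exact ⟨.pocket r m, hi, rfl, by simp only [ord, south, stepsS]; omega⟩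
    · rcases m with _ | m
      · refine ⟨.mid, ?_, by simp [abs, south, h5], by simp only [ord, stepsS]; norm_num; ring⟩
        simpa [lab, south, List.head?_eq_getElem?] using hi
      · refine ⟨.queue m, ?_, by simp [abs, south, h5]; ring, by simp [ord, stepsS]⟩
        simpa [lab, south, List.getElem?_tail] using hi
    · refine ⟨.tube s.t.length, ?_, by simp [abs, south, h6], by simp [ord, stepsS]; ring⟩
      simp only [lab] at hi
      simp [lab, south, hi]
    · have hn : n < s.t.length := by simpa using congrArg Option.isSome hi
      refine ⟨.tube n, ?_, by simp [abs, south, hn, h8], by simp [ord, stepsS]⟩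
      simpa [lab, south, List.getElem?_append_left hn] using hi
    · exact ⟨.pit i j, hi, rfl, by simp [ord, stepsS]⟩
  · rcases i with ⟨r, m⟩ | m | _ | n | ⟨i, j⟩
    · exact ⟨.pocket r m, hi, rfl, by simp only [ord, south, stepsS]; omega⟩
    · refine ⟨.queue (m + 1), ?_, by simp [abs, south, h5]; ring, by simp [ord, stepsS]⟩
      simpa [lab, south, List.getElem?_tail] using hi
    · refine ⟨.queue 0, ?_, by simp [abs, south, h5], by simp only [ord, stepsS]; norm_num; ring⟩
      simpa [lab, south, List.head?_eq_getElem?] using hi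
    · simp only [lab, south] at hi
      rcases Nat.lt_or_ge n s.t.length with hn | hn
      · rw [List.getElem?_append_left hn] at hi
        exact ⟨.tube n, hi, by simp [abs, south, hn, h8], by simp [ord, stepsS]⟩
      · rw [List.getElem?_append_right hn] at hi
        cases hmid : s.mid with
        | none => simp [hmid] at hi
        | some e =>
          rw [hmid] at hi
          refine ⟨.mid, ?_, ?_, by simp [ord, stepsS]; ring⟩
          · obtain ⟨hlt, -⟩ := List.getElem?_eq_some_iff.1 hi
            have : n - s.t.length = 0 := by simpa using hlt
            rw [this] at hi
            simpa [lab, hmid] using hi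
          · simp [abs, south, h6, Nat.not_lt.2 hn]
    · exact ⟨.pit i j, hi, rfl, by simp [ord, stepsS]⟩

/-- The number of steps of the tiles in a tilt to the south that drops the collected row. -/
def stepsDrop (b : ℕ) (s : Stage Λ) : Slot → ℕ
  | .pocket _ _ => 2
  | .queue _ => 0
  | .mid => 0
  | .tube _ => b + 1 - s.rows
  | .pit _ _ => 0

/-- The state after a tilt to the south that drops the collected row, and the lowest layer. -/
def drop (L : ℕ) (s : Stage Λ) : Stage Λ :=
  { s with
    layers := s.layers - 1
    lay := fun r => s.lay (r + 1)
    v := 2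
    q := if s.layers = 0 then [] else (List.range L).map (s.lay 0)
    xq := fun m => 3 * (L - m) - 1
    t := []
    rows := s.rows + 1
    -- The default is never read for an actual tile: a loaded tube has length `a`, and pit slots
    -- have `j < a`.
    row := fun i j => if i < s.rows then s.row i j else (s.t[j]?).getD (s.row i j) }

/-- The tiles of the machine are in the positions that a tilt to the west leads to, the row in the
tube is complete, and the other tiles are in pockets or finished. -/
structure Loaded (a b : ℕ) (s : Stage Λ) : Prop where
  layers_le : s.layers ≤ b
  u_eq : s.u = 0
  v_eq : s.v = 0
  q_eq : s.q = []
  mid_eq : s.mid = none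
  t_length : s.t.length = a
  xt_eq : ∀ n, s.xt n = 2 + (a - 1 - n)
  rows_le : s.rows ≤ b

lemma Loaded.valid (hs : s.Loaded a b) : s.Valid a b L := by
  obtain ⟨h1, h2, h3, h4, h5, h6, h7, h8⟩ := hs
  refine ⟨h1, Or.inl h2, Or.inl h3, ?_, ?_, ?_, ?_, ?_, ?_, h8⟩ <;> intros <;>
    simp only [h4, h7, List.length_nil] at * <;> omega

lemma Loaded.valid_drop (hs : s.Loaded a b) (hr : s.rows < b) : (s.drop L).Valid a b L := by
  obtain ⟨h1, h2, h3, h4, h5, h6, h7, h8⟩ := hs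
  have hq : (s.drop L).q.length ≤ L := by
    simp only [drop]
    split_ifs <;> simp
  refine ⟨(Nat.sub_le _ _).trans h1, Or.inl h2, Or.inr rfl, ?_, ?_, ?_, ?_, ?_, ?_, hr⟩
  · intro m m' h h'
    simp only [drop]
    omega
  · intro m h
    change _ ≤ 3 * ((L : ℤ) - m) - 1
    omega
  · intro m h
    change 3 * ((L : ℤ) - m) - 1 ≤ _
    omega
  all_goals
    simp only [drop, List.length_nil]
    intros
    omega

/-- The whole collected row falls by the same amount, so its horizontal bonds do no harm, and it
lands on the full row below or on the floor. The layers, now in their western columns, fall by two;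
the lowest one lands in the queue corridor, beside the shaft and not over it. -/
lemma motion_drop (G : Λ → Λ → Bool) (hs : s.Loaded a b) (ha : 0 < a) :
    Config.Motion (machineBoard a b L) G .S (s.lab a L) (s.abs a L) (s.ord b)
      (s.stepsDrop b) := by
  have inj := (hs.valid (L := L)).inj
  obtain ⟨h1, h2, h3, h4, h5, h6, h7, h8⟩ := hs
  have opn : ∀ i, (s.lab a L i).isSome → ∀ t : ℕ, t ≤ s.stepsDrop b i →
      (s.abs a L i, s.ord b i + -t) ∈ (machineBoard a b L).opn := by
    rintro (⟨r, m⟩ | m | _ | n | ⟨i, j⟩) hi t ht <;>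
      simp only [abs, ord, lab_pocket_isSome, lab_queue_isSome, lab_mid_isSome,
        lab_tube_isSome, lab_pit_isSome, stepsDrop, mem_machine_opn, h4, h5, h7,
        List.length_nil, Option.isSome_none, Nat.not_lt_zero, Bool.false_eq_true] at hi ht ⊢
    · rcases Nat.lt_or_ge (4 * r + 1) t with h | h
      · rw [openAt_queue (by omega)]
        omega
      · rw [openAt_pocket (by omega)]
        omega
    · rcases Nat.eq_zero_or_pos t with rfl | h
      · rw [openAt_tube (by omega)]
        omega
      · rw [openAt_low (by omega)]
        omega
    · rw [openAt_low (by omega)]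
      omega
  refine ⟨inj, ?_, ?_, ?_, ?_, ?_, ?_⟩ <;>
    simp only [Dir.vec, mul_one, mul_zero, add_zero, mul_neg]
  · exact fun i hi t ht => opn i hi t ht.le
  · exact fun i hi _ => opn i hi _ le_rfl
  · rintro (⟨r, m⟩ | m | _ | n | ⟨i, j⟩) (⟨r', m'⟩ | m' | _ | n' | ⟨i', j'⟩) hi hj p hp e1 e2 <;>
      simp only [abs, ord, lab_pocket_isSome, lab_queue_isSome, lab_mid_isSome,
        lab_tube_isSome, lab_pit_isSome, stepsDrop, h4, h5, h7,
        List.length_nil, Option.isSome_none, Nat.not_lt_zero, Bool.false_eq_true] at hi hj e1 e2 ⊢ <;>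
      omega
  · intro i j c d hi hj _ t e1 e2
    have hi' : (s.lab a L i).isSome := by simp [hi]
    have hj' : (s.lab a L j).isSome := by simp [hj]
    rcases i with ⟨r, m⟩ | m | _ | n | ⟨i₀, j₀⟩ <;>
      rcases j with ⟨r', m'⟩ | m' | _ | n' | ⟨i', j'⟩ <;>
      simp only [abs, ord, lab_pocket_isSome, lab_queue_isSome, lab_mid_isSome,
        lab_tube_isSome, lab_pit_isSome, stepsDrop, h4, h5, h7,
        List.length_nil, Option.isSome_none, Nat.not_lt_zero, Bool.false_eq_true] at hi' hj' e1 e2 ⊢ <;>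
      omega
  · rintro (⟨r, m⟩ | m | _ | n | ⟨i, j⟩) hi - <;>
      simp only [abs, ord, lab_pocket_isSome, lab_queue_isSome, lab_mid_isSome,
        lab_tube_isSome, lab_pit_isSome, stepsDrop, mem_machine_blocked, h4, h5, h7,
        List.length_nil, Option.isSome_none, Nat.not_lt_zero, Bool.false_eq_true] at hi ⊢
    · rcases Nat.eq_zero_or_pos r with rfl | h
      · rw [openAt_shaft (by omega)]
        omega
      · rw [openAt_pocket (by omega)]
        omega
    · rcases Nat.eq_zero_or_pos s.rows with h0 | h0
      · rw [openAt_low (by omega)]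
        omega
      · have o := opn (.pit (s.rows - 1) n) (by simp; omega) 0 (by simp)
        have e : s.ord b (.pit (s.rows - 1) n) + -((0 : ℕ) : ℤ) =
            b + 3 + -((b + 1 - s.rows : ℕ) + 1) := by
          simp only [ord]
          omega
        have e' : s.abs a L (.pit (s.rows - 1) n) = 2 + (a - 1 - n) := by
          simp only [abs]
          omega
        rw [e, e'] at o
        exact Or.inr ⟨o, .pit (s.rows - 1) n, by simp; omega, e', e, Nat.zero_le _⟩
    · rcases i with _ | i
      · rw [openAt_low (by omega)]
        omega
      · have o := opn (.pit i j) (by simp; omega) 0 (by simp)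
        have e : s.ord b (.pit i j) + -((0 : ℕ) : ℤ) = 2 + (i + 1 : ℕ) + -((0 : ℕ) + 1) := by
          simp only [ord]
          omega
        rw [e] at o
        exact Or.inr ⟨o, .pit i j, by simp; omega, rfl, e, le_rfl⟩
  · intro i c hi h
    exact absurd (Config.Motion.region_of_opn (opn i (by simp [hi]) _ le_rfl)) h

lemma tilt_drop (G : Λ → Λ → Bool) (hs : s.Loaded a b) (ha : 0 < a) :
    Config.Tilt G .S (s.conf a b L) ((s.drop L).conf a b L) := by
  have T := (motion_drop (L := L) G hs ha).tilt (b + 2) fun i hi => by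
    rcases i with ⟨r, m⟩ | m | _ | n | ⟨i₀, j₀⟩ <;> simp only [stepsDrop] <;> omega
  obtain ⟨h1, h2, h3, h4, h5, h6, h7, h8⟩ := hs
  simp only [Dir.vec, mul_one, mul_zero, add_zero, mul_neg] at T
  refine Eq.mp (congrArg _ (Config.ofFamily_congr (fun i c hi _ => ?_) (fun i c hi => ?_))) T
  · rcases i with ⟨r, m⟩ | m | _ | n | ⟨i, j⟩
    · obtain ⟨hr, hm⟩ := lab_pocket_isSome.1 (show (s.lab a L (.pocket r m)).isSome by simp [hi])
      rcases r with _ | r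
      · refine ⟨.queue m, ?_, by simp [abs, drop, h2], by simp [ord, stepsDrop, h3]; ring⟩
        have h0 : s.layers ≠ 0 := by omega
        simpa [lab, drop, hm, h0, hr] using hi
      · refine ⟨.pocket r m, ?_, by simp [abs, drop], by simp [ord, drop, stepsDrop, h3]; ring⟩
        have h0 : r < s.layers - 1 := by omega
        simpa [lab, drop, hm, h0, hr] using hi
    · simp [lab, h4] at hi
    · simp [lab, h5] at hi
    · have hn : n < a := by simpa [h6] using congrArg Option.isSome hi
      refine ⟨.pit s.rows n, ?_, by simp only [abs, h7]; ring, ?_⟩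
      · simp only [lab] at hi
        simp [lab, drop, hn, hi]
      · simp only [ord, stepsDrop]
        omega
    · obtain ⟨hr, hm⟩ := lab_pit_isSome.1 (show (s.lab a L (.pit i j)).isSome by simp [hi])
      refine ⟨.pit i j, ?_, rfl, by simp [ord, stepsDrop]⟩
      simpa [lab, drop, hr, hm, Nat.lt_succ_of_lt hr] using hi
  · rcases i with ⟨r, m⟩ | m | _ | n | ⟨i, j⟩
    · obtain ⟨hr, hm⟩ := lab_pocket_isSome.1
        (show ((s.drop L).lab a L (.pocket r m)).isSome by simp [hi])
      refine ⟨.pocket (r + 1) m, ?_, by simp [abs, drop], by simp [ord, drop, stepsDrop, h3]; ring⟩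
      have h0 : r + 1 < s.layers := by simp only [drop] at hr; omega
      have h0' : r < s.layers - 1 := by omega
      simpa [lab, drop, hm, h0, h0'] using hi
    · refine ⟨.pocket 0 m, ?_, by simp [abs, drop, h2], by simp [ord, stepsDrop, h3]; ring⟩
      simp only [lab, drop] at hi
      split_ifs at hi with h0
      · simp at hi
      · have hm : m < L := by simpa using congrArg Option.isSome hi
        simpa [lab, hm, Nat.pos_of_ne_zero h0] using hi
    · simp [lab, drop, h5] at hi
    · simp [lab, drop] at hi
    · obtain ⟨hr, hm⟩ := lab_pit_isSome.1
        (show ((s.drop L).lab a L (.pit i j)).isSome by simp [hi])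
      simp only [lab, if_pos (And.intro hr hm)] at hi
      simp only [drop] at hi hr
      rcases Nat.lt_or_ge i s.rows with hi' | hi'
      · refine ⟨.pit i j, ?_, rfl, by simp [ord, stepsDrop]⟩
        simpa [lab, hi', hm] using hi
      · obtain rfl : i = s.rows := by omega
        refine ⟨.tube j, ?_, by simp only [abs, h7]; ring, ?_⟩
        · simpa [lab, h6, hm] using hi
        · simp only [ord, stepsDrop]
          omega

end Stage
-- Programs for the machine
lemma Config.TiltSequence.append {Λ : Type} {G : Λ → Λ → Bool} {D D' : List Dir}
    {C C' C'' : Config Λ} (h : TiltSequence G D C C') (h' : TiltSequence G D' C' C'') :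
    TiltSequence G (D ++ D') C C'' := by
  induction D generalizing C with
  | nil =>
    cases h
    exact h'
  | cons d D ih =>
    obtain ⟨C₁, h1, h2⟩ := h
    exact ⟨C₁, h1, ih h2⟩

lemma Config.TiltSequence.reconfigures {Λ : Type} {G : Λ → Λ → Bool} {D : List Dir}
    {C C' : Config Λ} (h : TiltSequence G D C C') (hD : D ≠ []) : Reconfigures G C C' := by
  induction D generalizing C with
  | nil => exact absurd rfl hD
  | cons d D ih =>
    obtain ⟨C₁, h1, h2⟩ := h
    cases D with
    | nil =>
      cases h2
      exact Relation.TransGen.single ⟨d, h1⟩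
    | cons d' D => exact Relation.TransGen.head ⟨d, h1⟩ (ih h2 (by simp))

namespace Stage

variable {Λ : Type} {a b L : ℕ} {s : Stage Λ}

lemma Valid.west (hs : s.Valid a b L) : s.west.Valid a b L := by
  obtain ⟨h1, h2, h3, h4, h5, h6, h7, h8, h9, h10⟩ := hs
  refine ⟨h1, Or.inl rfl, h3, ?_, ?_, ?_, ?_, ?_, ?_, h10⟩ <;> simp only [Stage.west] <;>
    intro m hm
  · omega
  · omega
  · have := h5 m hm
    have := h6 m hm
    omega
  · omega
  · omega
  · have := h8 m hm
    have := h9 m hm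
    omega

lemma Valid.ready_east (hs : s.Valid a b L) (hq : s.q.length ≤ L)
    (ht : s.t.length + s.mid.toList.length ≤ a) : (s.east a L).Ready a b L :=
  ⟨hs.layers_le, rfl, hs.v_mem, hq, fun _ => rfl, rfl, ht, fun _ => rfl, hs.rows_le⟩

/-- The machine is idle: the queue is empty, and a complete row has been collected. -/
structure Idle (a b L : ℕ) (s : Stage Λ) : Prop extends s.Ready a b L where
  v_eq : s.v = 0
  q_eq : s.q = []
  mid_eq : s.mid = none
  t_eq : s.t.length = a

/-- Every sublist of the queue can be collected. -/
lemma exists_collect (G : Λ → Λ → Bool) (haL : a ≤ L) (ha : 0 < a) {q l : List Λ}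
    (hl : l.Sublist q) (hs : s.Ready a b L) (hsq : s.q = q)
    (hq : q.IsChain fun c d => ¬ Sticks G c d)
    (ht : s.t.length + s.mid.toList.length + l.length = a) :
    ∃ (D : List Dir) (s' : Stage Λ), D.length ≤ 3 * q.length + 2 ∧
      Config.TiltSequence G D (s.conf a b L) (s'.conf a b L) ∧ s'.Idle a b L ∧
      s'.t = s.t ++ s.mid.toList ++ l ∧ s'.layers = s.layers ∧ s'.lay = s.lay ∧
      s'.rows = s.rows ∧ s'.row = s.row := by
  have head : ∀ {q : List Λ} {s : Stage Λ}, s.q = q → (q.IsChain fun c d => ¬ Sticks G c d) →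
      ∀ c d, s.q[0]? = some c → s.q[1]? = some d → ¬ Sticks G c d := by
    rintro q s rfl hq c d hc hd
    cases e : s.q with
    | nil => simp [e] at hc
    | cons x q =>
      cases q with
      | nil => simp [e] at hd
      | cons y q =>
        rw [e] at hq hc hd
        simp only [List.getElem?_cons_zero, List.getElem?_cons_succ, Option.some.injEq] at hc hd
        rw [← hc, ← hd]
        exact (List.isChain_cons_cons.1 hq).1
  induction hl generalizing s with
  | slnil =>
    have t1 := tilt_south G hs haL ha (head hsq hq)
    have hv := hs.valid_south haL
    have t2 := tilt_east G hv haL ha fun _ => rfl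
    refine ⟨[.S, .E], _, by simp, ⟨_, t1, _, t2, rfl⟩, ⟨hv.ready_east ?_ ?_, rfl, ?_, ?_, ?_⟩,
      ?_, rfl, rfl, rfl, rfl⟩
    all_goals simp [south, east, hsq] at ht ⊢ <;> omega
  -- The head `x` is discarded by S, W, E.
  | @cons l q x hl ih =>
    have t1 := tilt_south G hs haL ha (head hsq hq)
    have hv := hs.valid_south haL
    have t2 := tilt_west G hv haL ha fun _ => rfl
    have t3 := tilt_east G hv.west haL ha fun h => by simp [west] at h
    have hL := hs.q_length
    have hr : (((s.south a L).west).east a L).Ready a b L := by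
      refine hv.west.ready_east ?_ ?_ <;> simp [south, west] <;> omega
    obtain ⟨D, s', hD, hT, hI, h1, h2, h3, h4, h5⟩ := ih hr (by simp [south, west, east, hsq])
      (List.IsChain.tail hq) (by simp [south, west, east]; omega)
    refine ⟨.S :: .W :: .E :: D, s', by simp; omega, ⟨_, t1, _, t2, _, t3, hT⟩, hI, ?_, h2, h3,
      h4, h5⟩
    simpa [south, west, east] using h1
  -- The head `x` is kept by S, E. It becomes the waiting tile and enters the tube with the next
  -- tilt south.
  | @cons_cons l q x hl ih =>
    have t1 := tilt_south G hs haL ha (head hsq hq)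
    have hv := hs.valid_south haL
    have t2 := tilt_east G hv haL ha fun _ => rfl
    have hL := hs.q_length
    simp only [List.length_cons] at ht
    have hr : ((s.south a L).east a L).Ready a b L := by
      refine hv.ready_east ?_ ?_ <;> simp [south, hsq] at hL ⊢ <;> omega
    obtain ⟨D, s', hD, hT, hI, h1, h2, h3, h4, h5⟩ := ih hr (by simp [south, east, hsq])
      (List.IsChain.tail hq) (by simp [south, east, hsq]; omega)
    refine ⟨.S :: .E :: D, s', by simp; omega, ⟨_, t1, _, t2, hT⟩, hI, ?_, h2, h3, h4, h5⟩
    simpa [south, east, hsq] using h1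

lemma Idle.loaded_west (hs : s.Idle a b L) : s.west.Loaded a b :=
  ⟨hs.layers_le, rfl, hs.v_eq, hs.q_eq, rfl, hs.t_eq, fun n => by simp [west, hs.t_eq], hs.rows_le⟩

/-- An idle machine can be made to finish the collected row and a choice of rows from its
layers. -/
lemma exists_finish (G : Λ → Λ → Bool) (haL : a ≤ L) (ha : 0 < a) (n : ℕ) (tgt : ℕ → ℕ → Λ)
    (hs : s.Idle a b L) (hn : s.layers = n) (hr : s.rows + n = b)
    (hlay : ∀ r < n, ((List.range L).map (s.lay r)).IsChain fun c d => ¬ Sticks G c d)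
    (htgt : ∀ r < n, ((List.range a).map (tgt r)).Sublist ((List.range L).map (s.lay r))) :
    ∃ (D : List Dir) (s' : Stage Λ), D ≠ [] ∧ D.length ≤ n * (3 * L + 5) + 2 ∧
      Config.TiltSequence G D (s.conf a b L) (s'.conf a b L) ∧
      s'.layers = 0 ∧ s'.q = [] ∧ s'.mid = none ∧ s'.t = [] ∧ s'.rows = b + 1 ∧
      (∀ i < s.rows, ∀ j < a, s'.row i j = s.row i j) ∧
      (∀ j < a, s.t[j]? = some (s'.row s.rows j)) ∧
      ∀ r < n, ∀ j < a, s'.row (s.rows + 1 + r) j = tgt r j := by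
  have step : ∀ {s : Stage Λ}, s.Idle a b L →
      Config.TiltSequence G [.W, .S] (s.conf a b L) ((s.west.drop L).conf a b L) := by
    intro s hs
    exact ⟨_, tilt_west G hs.valid haL ha fun h => by simp [hs.mid_eq] at h, _,
      tilt_drop G hs.loaded_west ha, rfl⟩
  have row_t : ∀ {s : Stage Λ}, s.Idle a b L → ∀ j < a,
      s.t[j]? = some ((s.west.drop L).row s.rows j) := by
    intro s hs j hj
    have : j < s.t.length := by rwa [hs.t_eq]
    simp [drop, west, this]
  induction n generalizing s tgt with
  | zero =>
    refine ⟨[.W, .S], _, by simp, by simp, step hs, by simp [drop, west, hn],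
      by simp [drop, west, hn], rfl, rfl, by simp [drop, west]; omega, ?_, row_t hs, by simp⟩
    intro i hi j _
    simp [drop, west, hi]
  | succ n ih =>
    have hv : (s.west.drop L).Valid a b L :=
      hs.loaded_west.valid_drop (show s.rows < b by omega)
    have t3 := tilt_east G hv haL ha fun h => by simp [drop, west] at h
    have hq : (s.west.drop L).q = (List.range L).map (s.lay 0) := by simp [drop, west, hn]
    have hr1 : ((s.west.drop L).east a L).Ready a b L :=
      hv.ready_east (by simp [hq]) (by simp [drop, west])
    obtain ⟨D, s₁, hD, hT, hI, h1, h2, h3, h4, h5⟩ := exists_collect G haL ha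
      (htgt 0 (by omega)) hr1 hq (hlay 0 (by omega)) (by simp [drop, west, east])
    have e1 : s₁.t = (List.range a).map (tgt 0) := by simpa [drop, west, east] using h1
    have e2 : s₁.layers = n := by simpa [drop, west, east, hn] using h2
    have e3 : s₁.lay = fun r => s.lay (r + 1) := h3
    have e4 : s₁.rows = s.rows + 1 := h4
    have e5 : s₁.row = (s.west.drop L).row := h5
    obtain ⟨D', s', hne, hD', hT', f1, f2, f3, f4, f5, f6, f7, f8⟩ := ih
      (fun r => tgt (r + 1)) hI e2 (by omega)
      (fun r hrn => by rw [e3]; exact hlay (r + 1) (by omega))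
      (fun r hrn => by rw [e3]; exact htgt (r + 1) (by omega))
    have hE : Config.TiltSequence G (.E :: (D ++ D')) ((s.west.drop L).conf a b L)
        (s'.conf a b L) := ⟨_, t3, hT.append hT'⟩
    -- A layer costs W, S, E and at most `3 * L + 2` tilts for the collection; the remaining 2 in
    -- the bound are the last W, S.
    refine ⟨[.W, .S] ++ (.E :: (D ++ D')), s', by simp, ?_, (step hs).append hE, f1, f2, f3, f4, f5, ?_, ?_, ?_⟩
    · simp only [List.length_map, List.length_range] at hD
      simp only [List.length_append, List.length_cons, List.length_nil]
      rw [Nat.succ_mul]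
      omega
    · intro i hi j hj
      rw [f6 i (by omega) j hj, e5]
      simp [drop, west, hi]
    · intro j hj
      rw [f6 s.rows (by omega) j hj, e5]
      exact row_t hs j hj
    · intro r hrn j hj
      rcases r with _ | r
      · have := f7 j hj
        rw [e1, e4] at this
        simpa [hj] using this.symm
      · have := f8 r (by omega) j hj
        rw [e4] at this
        rw [← this]
        congr 1
        omega

/-- Every tile that is left lies in the pit, so the labels of the final configuration can be read
off the rows. -/
lemma label_of_finished (h1 : s.layers = 0) (h2 : s.q = []) (h3 : s.mid = none) (h4 : s.t = [])
    (h5 : s.rows = b + 1) (c : Cell) (e : Λ) :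
    (s.conf a b L).label c = some e ↔
      ∃ i j : ℕ, i ≤ b ∧ j < a ∧ c = ((a : ℤ) + 1 - j, 2 + (i : ℤ)) ∧ s.row i j = e := by
  have only : ∀ i, (s.lab a L i).isSome → ∃ r j, i = .pit r j ∧ r ≤ b ∧ j < a := by
    rintro (⟨r, m⟩ | m | _ | n | ⟨i, j⟩) hi
    all_goals simp [h1, h2, h3, h4, h5] at hi
    exact ⟨i, j, rfl, by omega, hi.2⟩
  rw [conf, Config.ofFamily_label]
  · constructor
    · rintro ⟨-, i, hi, rfl⟩
      obtain ⟨r, j, rfl, hr, hj⟩ := only i (by simp [hi])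
      refine ⟨r, j, hr, hj, rfl, ?_⟩
      have : r < b + 1 := by omega
      simpa [lab, h5, hj, this] using hi
    · rintro ⟨i, j, hi, hj, rfl, rfl⟩
      refine ⟨?_, .pit i j, ?_, rfl⟩
      · rw [mem_machine_opn, openAt_low (by omega)]
        omega
      · have : i < b + 1 := by omega
        simp [lab, h5, hj, this]
  · intro i j hi hj _ e1 e2
    obtain ⟨r, m, rfl, hr, hm⟩ := only i hi
    obtain ⟨r', m', rfl, hr', hm'⟩ := only j hj
    simp only [abs, ord] at e1 e2
    rw [Slot.pit.injEq]
    omega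

end Stage
-- Labels, supply and the finished shape
/-- The affinity on symbols and a helper label `none`: all symbols stick to each other. -/
def symbolAffinity (α : Type) (c d : Option α) : Bool := c.isSome && d.isSome

lemma sticks_symbolAffinity {α : Type} {c d : Option α} :
    Sticks (symbolAffinity α) c d ↔ c.isSome ∧ d.isSome := by
  simp only [Sticks, symbolAffinity, Bool.and_eq_true]
  tauto

/-- A configuration weakly represents a patterned shape if the tiles that are not helpers form a
translate of the shape. -/
lemma weaklyRepresents_of_label {α : Type} {C : Config (Option α)} {u : PatternedShape α} {v : Cell}
    (h : ∀ c x, C.label c = some (some x) ↔ ∃ p : u.cells, c = p.1 + v ∧ u.symbol p = x) :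
    C.WeaklyRepresents (symbolAffinity α) Function.Embedding.some u := by
  have hlab : ∀ p : u.cells, C.label (p.1 + v) = some (some (u.symbol p)) :=
    fun p => (h _ _).2 ⟨p, rfl, rfl⟩
  have hadj : ∀ {c d : Cell}, (C.bondGraph (symbolAffinity α)).Adj c d →
      ∃ x, C.label c = some (some x) := by
    rintro c d ⟨-, e, f, he, hf, hef⟩
    obtain ⟨x, rfl⟩ := Option.isSome_iff_exists.1 (sticks_symbolAffinity.1 hef).1
    exact ⟨x, he⟩
  -- Connectedness of the shape is transported to the bonding graph, since any two symbols stick.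
  let F : gridGraph.induce (u.cells : Set Cell) →g C.bondGraph (symbolAffinity α) :=
    { toFun := fun p => p.1 + v
      map_rel' := by
        intro p q hpq
        refine ⟨?_, _, _, hlab p, hlab q, sticks_symbolAffinity.2 (by simp)⟩
        have : Adjacent p.1 q.1 := hpq
        simpa [Adjacent] using this }
  have hpoly : ∀ p : u.cells, C.polyominoAt (symbolAffinity α) (p.1 + v) =
      u.tiles Function.Embedding.some v := by
    intro p
    ext ⟨c, e⟩
    constructor
    · rintro ⟨hr, he⟩
      change C.label c = some e at he
      have hx : ∃ x, C.label c = some (some x) := by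
        obtain ⟨w⟩ := hr.symm
        cases w with
        | nil => exact ⟨_, hlab p⟩
        | cons hadj' _ => exact hadj hadj'
      obtain ⟨x, hx⟩ := hx
      obtain ⟨q, rfl, rfl⟩ := (h _ _).1 hx
      refine ⟨q, ?_⟩
      rw [hx, Option.some.injEq] at he
      rw [← he]
      rfl
    · rintro ⟨q, hq⟩
      rw [Prod.mk.injEq] at hq
      obtain ⟨rfl, rfl⟩ := hq
      exact ⟨(u.connected.preconnected p q).map F, hlab q⟩
  obtain ⟨p⟩ := u.connected.nonempty
  refine ⟨v, ⟨_, ⟨_, hlab p⟩, (hpoly p).symm⟩, ?_⟩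
  rintro Q ⟨q, ⟨e, he⟩, rfl⟩ hne
  cases e with
  | some x =>
    obtain ⟨p, rfl, -⟩ := (h _ _).1 he
    exact absurd (hpoly p) hne
  | none =>
    refine ⟨q, none, ?_, fun d hd => by simpa using (sticks_symbolAffinity.1 hd).1⟩
    ext ⟨c, f⟩
    simp only [Config.polyominoAt, Set.mem_ofPred_eq, Set.mem_singleton_iff, Prod.mk.injEq]
    constructor
    · rintro ⟨⟨w⟩, hf⟩
      cases w with
      | nil =>
        rw [he, Option.some.injEq] at hf
        exact ⟨rfl, hf.symm⟩
      | cons hadj' _ =>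
        obtain ⟨x, hx⟩ := hadj hadj'
        simp [he] at hx
    · rintro ⟨rfl, rfl⟩
      exact ⟨SimpleGraph.Reachable.refl _, he⟩

/-- The layers of the supply: symbols in cyclic order and helpers, as on a checkerboard. -/
def supply (k r m : ℕ) : Option (Fin (k + 1)) :=
  if (r + m) % 2 = 0 then some (Fin.ofNat (k + 1) (m / 2)) else none

/-- One of any two consecutive tiles is a helper, by parity. -/
lemma isChain_supply (k r L : ℕ) : ((List.range L).map (supply k r)).IsChain
    fun c d => ¬ Sticks (symbolAffinity (Fin (k + 1))) c d := by
  rw [List.isChain_map, List.isChain_iff_getElem]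
  intro i hi
  simp only [List.getElem_range, sticks_symbolAffinity, supply]
  rintro ⟨h1, h2⟩
  split_ifs at h1 h2 with h3 h4 <;> first | omega | simp at h1 h2

/-- A block of `2 * (k + 1)` consecutive positions is a full period: a position of the wrong parity
carries a helper, and position `2 * x + r % 2` in the block carries the symbol `x`. -/
lemma exists_supply_eq (k r j : ℕ) (c : Option (Fin (k + 1))) :
    ∃ m < 2 * (k + 1), supply k r (2 * (k + 1) * j + m) = c := by
  have e : 2 * (k + 1) * j = 2 * ((k + 1) * j) := by ring
  cases c with
  | none =>
    refine ⟨1 - r % 2, by omega, ?_⟩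
    rw [supply, if_neg (by omega)]
  | some x =>
    have := x.2
    refine ⟨2 * x + r % 2, by omega, ?_⟩
    rw [supply, if_pos (by omega)]
    congr 1
    have e' : (2 * (k + 1) * j + (2 * x + r % 2)) / 2 = x + (k + 1) * j := by omega
    ext
    rw [e', Fin.val_ofNat, Nat.add_mul_mod_self_left, Nat.mod_eq_of_lt this]

/-- One tile is picked from each of the `a` blocks of a layer. -/
lemma sublist_supply (k r a : ℕ) (f : ℕ → Option (Fin (k + 1))) :
    ((List.range a).map f).Sublist ((List.range (2 * (k + 1) * a)).map (supply k r)) := by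
  induction a with
  | zero => simp
  | succ a ih =>
    rw [List.range_succ, List.map_append, Nat.mul_succ, List.range_add, List.map_append]
    refine ih.append ?_
    obtain ⟨m, hm, e⟩ := exists_supply_eq k r a (f a)
    rw [List.map_singleton, List.singleton_sublist, List.mem_map]
    exact ⟨_, List.mem_map.2 ⟨m, List.mem_range.2 hm, rfl⟩, e⟩

/-- The initial state of the machine. -/
def initialStage (k a b L : ℕ) : Stage (Option (Fin (k + 1))) where
  layers := b
  lay := supply k
  u := 1
  v := 0
  q := []
  xq := fun m => 3 * L - m
  mid := none
  xm := 3 * L + 1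
  t := List.replicate a none
  xt := fun n => 3 * L + 1 + a - n
  rows := 0
  row := fun _ _ => none

lemma idle_initialStage (k a b L : ℕ) : (initialStage k a b L).Idle a b L where
  layers_le := le_rfl
  u_eq := rfl
  v_mem := Or.inl rfl
  q_length := Nat.zero_le _
  xq_eq _ := rfl
  xm_eq := rfl
  t_length := by simp [initialStage]
  xt_eq _ := rfl
  rows_le := Nat.zero_le _
  v_eq := rfl
  q_eq := rfl
  mid_eq := rfl
  t_eq := by simp [initialStage]

open Classical in
/-- The symbol of a patterned shape at a location, if there is one. -/
noncomputable def PatternedShape.symbolAt {α : Type} (u : PatternedShape α) (c : Cell) : Option α :=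
  if h : c ∈ u.cells then some (u.symbol ⟨c, h⟩) else none

lemma PatternedShape.symbolAt_eq_some {α : Type} {u : PatternedShape α} {c : Cell} {x : α} :
    u.symbolAt c = some x ↔ ∃ p : u.cells, p.1 = c ∧ u.symbol p = x := by
  unfold symbolAt
  split_ifs with h
  · rw [Option.some.injEq]
    constructor
    · intro e; exact ⟨⟨c, h⟩, rfl, e⟩
    · rintro ⟨p, rfl, e⟩; exact e
  · refine iff_of_false (by simp) ?_
    rintro ⟨p, rfl, -⟩
    exact h p.2

/-- The machine builds every patterned shape. -/
lemma exists_build (k a b : ℕ) (ha : 0 < a) (u : PatternedShape (Fin (k + 1)))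
    (hu : u ∈ patternedShapesIn (Fin (k + 1)) a b) :
    ∃ C' : Config (Option (Fin (k + 1))),
      C'.WeaklyRepresents (symbolAffinity _) Function.Embedding.some u ∧
      ∃ D : List Dir, D ≠ [] ∧ D.length ≤ b * (3 * (2 * (k + 1) * a) + 5) + 2 ∧
        Config.TiltSequence (symbolAffinity _) D
          ((initialStage k a b (2 * (k + 1) * a)).conf a b (2 * (k + 1) * a)) C' := by
  have haL : a ≤ 2 * (k + 1) * a := Nat.le_mul_of_pos_left a (by omega)
  obtain ⟨D, s, hne, hD, hT, h1, h2, h3, h4, h5, -, h7, h8⟩ := Stage.exists_finish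
    (symbolAffinity (Fin (k + 1))) haL ha b
    (fun r j => u.symbolAt ((a : ℤ) - j, (r : ℤ) + 1)) (idle_initialStage k a b _) rfl
    (by simp [initialStage]) (fun r _ => isChain_supply k r _) (fun r _ => sublist_supply k r a _)
  refine ⟨_, ?_, D, hne, hD, hT⟩
  -- The pit begins at `(2, 2)`, and its lowest row consists of the helpers that fill the tube
  -- initially, because the first drop must happen before any layer can be collected. So the
  -- location `(1, 1)` of the shape goes to `(2, 3)`.
  refine weaklyRepresents_of_label (v := (1, 2)) fun c x => ?_
  rw [Stage.label_of_finished h1 h2 h3 h4 h5]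
  constructor
  · rintro ⟨i, j, hi, hj, rfl, e⟩
    -- Row 0 of the pit holds the initial helpers, row `i + 1` the choice from layer `i`.
    rcases i with _ | i
    · have := h7 j hj
      simp only [initialStage, e] at this
      simp [hj] at this
    · have := h8 i (by omega) j hj
      simp only [initialStage, zero_add, Nat.add_comm 1 i, e] at this
      obtain ⟨p, hp, hx⟩ := PatternedShape.symbolAt_eq_some.1 this.symm
      refine ⟨p, ?_, hx⟩
      rw [hp, Prod.mk_add_mk, Prod.mk.injEq]
      push_cast
      constructor <;> ring
  · rintro ⟨p, rfl, rfl⟩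
    obtain ⟨b1, b2, b3, b4⟩ := hu p.2
    have := h8 (p.1.2 - 1).toNat (by omega) (a - p.1.1).toNat (by omega)
    have e : ((a : ℤ) - ((a - p.1.1).toNat : ℕ), (((p.1.2 - 1).toNat : ℕ) : ℤ) + 1) = p.1 := by
      rw [Prod.ext_iff]
      constructor <;> simp only <;> omega
    rw [e, PatternedShape.symbolAt_eq_some.2 ⟨p, rfl, rfl⟩] at this
    refine ⟨_, _, ?_, ?_, ?_, this⟩
    · simp only [initialStage]; omega
    · omega
    · rw [Prod.ext_iff]
      simp only [initialStage, Prod.fst_add, Prod.snd_add]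
      constructor <;> omega

end TiltAssembly

/-! ### Size and number of tilts -/

theorem mainTheorem10 :
    ∃ K : ℕ, ∀ h w k : ℕ, 0 < h → 0 < w → 0 < k →
      ∃ (Λ : Type) (_ : Finite Λ) (G : Λ → Λ → Bool) (enc : Fin (k + 1) ↪ Λ)
        (C : TiltAssembly.Config Λ),
        C.WeaklyUniversal G enc (TiltAssembly.patternedShapesIn (Fin (k + 1)) h w) ∧
        C.size ≤ K * (h * w * k) ∧
        ∀ u ∈ TiltAssembly.patternedShapesIn (Fin (k + 1)) h w,
          ∃ C' : TiltAssembly.Config Λ, C'.WeaklyRepresents G enc u ∧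
            ∃ D : List TiltAssembly.Dir, D ≠ [] ∧ D.length ≤ K * (h * w * k) ∧
              TiltAssembly.Config.TiltSequence G D C C' := by
  -- The constant is generous: the estimates below give size at most 210 and at most 19 tilts, in
  -- units of `h * w * k`.
  refine ⟨300, fun h w k hh hw hk => ?_⟩
  have hhk : h ≤ h * k := Nat.le_mul_of_pos_right h hk
  have hhk1 : 0 < h * k := Nat.mul_pos hh hk
  have hL : 2 * (k + 1) * h = 2 * (h * k) + 2 * h := by ring
  have hK : h * w * k = w * (h * k) := by ring
  refine ⟨Option (Fin (k + 1)), inferInstance, TiltAssembly.symbolAffinity _,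
    Function.Embedding.some,
    (TiltAssembly.initialStage k h w (2 * (k + 1) * h)).conf h w (2 * (k + 1) * h),
    ⟨{C' | TiltAssembly.Config.Reconfigures (TiltAssembly.symbolAffinity _)
      ((TiltAssembly.initialStage k h w (2 * (k + 1) * h)).conf h w (2 * (k + 1) * h)) C'},
      fun u hu => ?_, fun C' h => h⟩, ?_, fun u hu => ?_⟩
  · obtain ⟨C', hC', D, hne, -, hT⟩ := TiltAssembly.exists_build k h w hh u hu
    exact ⟨C', hT.reconfigures hne, hC'⟩
  · change (3 * (2 * (k + 1) * h) + h + 2) * (5 * w + 9) ≤ _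
    calc (3 * (2 * (k + 1) * h) + h + 2) * (5 * w + 9) ≤ (15 * (h * k)) * (14 * w) :=
          Nat.mul_le_mul (by omega) (by omega)
      _ ≤ 300 * (h * w * k) := by rw [hK]; nlinarith [Nat.zero_le (w * (h * k))]
  · obtain ⟨C', hC', D, hne, hD, hT⟩ := TiltAssembly.exists_build k h w hh u hu
    refine ⟨C', hC', D, hne, hD.trans ?_, hT⟩
    calc w * (3 * (2 * (k + 1) * h) + 5) + 2 ≤ w * (17 * (h * k)) + 2 * (w * (h * k)) := by
          refine Nat.add_le_add (Nat.mul_le_mul_left _ (by omega)) ?_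
          have := Nat.mul_pos hw hhk1
          omega
      _ ≤ 300 * (h * w * k) := by rw [hK]; nlinarith [Nat.zero_le (w * (h * k))]
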